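/- Let $\gamma>0$, $\rho^*>0$ and $p(\rho)=\bigl(\tfrac1\rho-\tfrac1{\rho^*}\bigr)^{-\gamma}$ for $0<\rho<\rho^*$. For $\varepsilon>0$ consider the system $$\partial_t\rho+\partial_x q=0,\qquad \partial_t q+\partial_x\Bigl(\frac{q^2}{\rho}+\varepsilon p(\rho)\Bigr)=0,$$ with characteristic speeds $\lambda_\pm^\varepsilon=\frac q\rho\pm\sqrt{\varepsilon p'(\rho)}$ ($-$: first family, $+$: second family), and the Riemann problem with left state $(\rho_\ell^\varepsilon,q_\ell^\varepsilon)$ and right state $(\rho_r^\varepsilon,q_r^\varepsilon)$, where $0<\rho_\ell^\varepsilon,\rho_r^\varepsilon<\rho^*$. The states may depend on $\varepsilon$ (or be constant), and we assume that, as $\varepsilon\to0^+$, $(\rho_\ell^\varepsilon,q_\ell^\varepsilon,\varepsilon p(\rho_\ell^\varepsilon))\to(\rho_\ell,q_\ell,\bar p_\ell)$ and $(\rho_r^\varepsilon,q_r^\varepsilon,\varepsilon p(\rho_r^\varepsilon))\to(\rho_r,q_r,\bar p_r)$ with finite limits and $\rho_\ell,\rho_r\in(0,\rho^*]$. Put $u_\ell^\varepsilon=q_\ell^\varepsilon/\rho_\ell^\varepsilon$,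 $u_\ell=q_\ell/\rho_\ell$, and similarly $u_r^\varepsilon,u_r$. A solution of the Riemann problem is a self-similar function $(\rho,q)(x/t)$, $t>0$, made of finitely many constant states separated by waves, the first state being the left one and the last state the right one. A wave of the $k$-th family is either a $k$-rarefaction (a continuous self-similar solution, of positive density and classical in the interior of a sector, each ray of which is a $k$-characteristic; an end state may be the vacuum $(0,0)$) or an entropic $k$-shock (a discontinuity between two states of positive density that satisfies the Rankine–Hugoniot conditions and Lax's entropy condition $\lambda_k(\text{right})<\sigma<\lambda_k(\text{left})$). For a state $(\hat\rho,\hat q)$, $\hat u=\hat q/\hat\rho$, the integral and Hugoniot curves issued from it are, for $0\le\rho<\rho^*$, $$i_\pm^\varepsilon(\rho)=\rho\hat u\pm\rho\sqrt\varepsilon\,(P(\rho)-P(\hat\rho)),\qquad P'(\rho)=\frac{\sqrt{p'(\rho)}}{\rho},$$ $$h_\pm^\varepsilon(\rho)=\rho\hat u\pm\operatorname{sgn}(\rho-\hat\rho)\sqrt{\frac{\rho}{\hat\rho}}\sqrt{(\rho-\hat\rho)(\varepsilon p(\rho)-\varepsilon p(\hat\rho))},$$ with value $0$ at $\rho=0$.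 Below, the 1-curves $i_-^\varepsilon,h_-^\varepsilon$ are issued from the left state and the 2-curves $i_+^\varepsilon,h_+^\varepsilon$ from the right state. The intersection point of two such curves is their intersection point with positive density, which is unique when it exists, or else the vacuum $(0,0)$. In each case below the Riemann problem has a solution, and all its solutions consist of the left state, a wave of the first family, one and the same intermediate state $(\tilde\rho,\tilde q)$, a wave of the second family, and the right state, as follows. 1. If $u_\ell<u_r$, then for all sufficiently small $\varepsilon>0$ both waves are rarefactions, $(\tilde\rho,\tilde q)$ is the intersection point of the 1-integral curve and the 2-integral curve (possibly the vacuum), and $\tilde\rho<\rho_\ell^\varepsilon$, $\tilde\rho<\rho_r^\varepsilon$. 2. For all sufficiently small $\varepsilon>0$, if $u_\ell^\varepsilon>u_r^\varepsilon$ (which holds for all small $\varepsilon$ when $u_\ell>u_r$): * if $h_-^\varepsilon(\rho_r^\varepsilon)>q_r^\varepsilon$ and $h_+^\varepsilon(\rho_\ell^\varepsilon)<q_\ell^\varepsilon$, both waves are shocks and $(\tilde\rho,\tilde q)$ is the intersection point of the 1-Hugoniot curve and the 2-Hugoniot curve; * if $h_-^\varepsilon(\rho_r^\varepsilon)<q_r^\varepsilon$,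 the waves are a 1-shock and a 2-rarefaction and $(\tilde\rho,\tilde q)$ is the intersection point of the 1-Hugoniot curve and the 2-integral curve; * if $h_+^\varepsilon(\rho_\ell^\varepsilon)>q_\ell^\varepsilon$, the waves are a 1-rarefaction and a 2-shock and $(\tilde\rho,\tilde q)$ is the intersection point of the 1-integral curve and the 2-Hugoniot curve. 3. For every $\varepsilon>0$ with $u_\ell^\varepsilon=u_r^\varepsilon$: if $\rho_\ell^\varepsilon<\rho_r^\varepsilon$, the waves are a 1-shock and a 2-rarefaction, $(\tilde\rho,\tilde q)$ is the intersection point of the 1-Hugoniot curve and the 2-integral curve, and $\tilde\rho\in[\rho_\ell^\varepsilon,\rho_r^\varepsilon]$; if $\rho_\ell^\varepsilon>\rho_r^\varepsilon$, the waves are a 1-rarefaction and a 2-shock, $(\tilde\rho,\tilde q)$ is the intersection point of the 1-integral curve and the 2-Hugoniot curve, and $\tilde\rho\in[\rho_r^\varepsilon,\rho_\ell^\varepsilon]$. -/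

import Mathlib

open Set Filter Topology

noncomputable section

/-- The singular pressure `p(ρ) = 1 / (1/ρ - 1/ρ*)^γ`, meaningful for `0 < ρ < ρ*`. -/
def pressure (γ ρs ρ : ℝ) : ℝ := 1 / (1 / ρ - 1 / ρs) ^ γ

/-- The two characteristic families (first: sign `-`, second: sign `+`). -/
inductive Family
  | first
  | second

/-- The sign `∓` attached to a characteristic family. -/
def Family.sgn : Family → ℝ
  | .first => -1
  | .second => 1

/-- Characteristic speeds `λ_± = u ± √(ε p'(ρ))`, `u = q/ρ`, at a state `(ρ, q)` with `ρ > 0`. -/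
def charSpeed (γ ρs ε : ℝ) (k : Family) (v : ℝ × ℝ) : ℝ :=
  v.2 / v.1 + k.sgn * Real.sqrt (ε * deriv (pressure γ ρs) v.1)

/-- The antiderivative of `√(p'(s)) / s` on `(0, ρ*)` that vanishes at `ρ*/2`
(only differences of its values are used). -/
def soundPotential (γ ρs ρ : ℝ) : ℝ :=
  ∫ s in (ρs / 2)..ρ, Real.sqrt (deriv (pressure γ ρs) s) / s

/-- The integral curves `i_±(ρ) = ρ û ± ρ √ε (P(ρ) - P(ρ̂))` issued from `v = (ρ̂, q̂)`;
in particular `i_±(0) = 0`. -/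
def integralCurve (γ ρs ε : ℝ) (k : Family) (v : ℝ × ℝ) (ρ : ℝ) : ℝ :=
  ρ * (v.2 / v.1) +
    k.sgn * (ρ * Real.sqrt ε * (soundPotential γ ρs ρ - soundPotential γ ρs v.1))

/-- The Hugoniot curves issued from `v = (ρ̂, q̂)`:
`h_±(ρ) = ρ û ± sign(ρ - ρ̂) √(ρ/ρ̂) √((ρ - ρ̂)(ε p(ρ) - ε p(ρ̂)))`, that is
`h_±(ρ) = q̂ + σ_± (ρ - ρ̂)` with the shock speeds
`σ_± = û ± √(ρ/ρ̂) √((ε p(ρ) - ε p(ρ̂)) / (ρ - ρ̂))`; in particular `h_±(0) = 0`. -/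
def hugoniotCurve (γ ρs ε : ℝ) (k : Family) (v : ℝ × ℝ) (ρ : ℝ) : ℝ :=
  ρ * (v.2 / v.1) +
    k.sgn * (Real.sign (ρ - v.1) * (Real.sqrt (ρ / v.1) *
      Real.sqrt ((ρ - v.1) * (ε * pressure γ ρs ρ - ε * pressure γ ρs v.1))))

/-- The momentum flux `q²/ρ + ε p(ρ)`. -/
def momentumFlux (γ ρs ε ρ q : ℝ) : ℝ := q ^ 2 / ρ + ε * pressure γ ρs ρ

/-- `(ρ, q)(t, x)` is differentiable at `(t, x)` in `t` and in `x` and satisfies there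
`∂ₜρ + ∂ₓq = 0` and `∂ₜq + ∂ₓ(q²/ρ + ε p(ρ)) = 0`. -/
def SolvesEulerAt (γ ρs ε : ℝ) (ρ q : ℝ → ℝ → ℝ) (t x : ℝ) : Prop :=
  ∃ ρt ρx qt qx fx : ℝ,
    HasDerivAt (fun s => ρ s x) ρt t ∧ HasDerivAt (fun y => ρ t y) ρx x ∧
    HasDerivAt (fun s => q s x) qt t ∧ HasDerivAt (fun y => q t y) qx x ∧
    HasDerivAt (fun y => momentumFlux γ ρs ε (ρ t y) (q t y)) fx x ∧
    ρt + qx = 0 ∧ qt + fx = 0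

/-- The two states `L` (left) and `R` (right) are separated by an entropic `k`-shock of speed `σ`:
the Rankine-Hugoniot conditions and Lax's entropy condition hold. (A jump to the vacuum never
satisfies the Rankine-Hugoniot conditions, so both densities are positive.) -/
def IsShock (γ ρs ε : ℝ) (k : Family) (σ : ℝ) (L R : ℝ × ℝ) : Prop :=
  (0 < L.1 ∧ L.1 < ρs) ∧ (0 < R.1 ∧ R.1 < ρs) ∧
  R.2 - L.2 = σ * (R.1 - L.1) ∧
  momentumFlux γ ρs ε R.1 R.2 - momentumFlux γ ρs ε L.1 L.2 = σ * (R.2 - L.2) ∧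
  charSpeed γ ρs ε k R < σ ∧ σ < charSpeed γ ρs ε k L

/-- The self-similar function `(t, x) ↦ U (x / t)` is on the sector `a ≤ x/t ≤ b` a (centred)
`k`-rarefaction wave joining `L` to `R`: it is continuous, takes the values `L` and `R` on the two
edges, and inside it has positive density, is a classical solution of the system, and each ray
`x/t = ξ` is a `k`-characteristic. An end state may be the vacuum. -/
def IsRarefaction (γ ρs ε : ℝ) (k : Family) (U : ℝ → ℝ × ℝ) (a b : ℝ) (L R : ℝ × ℝ) : Prop :=
  a < b ∧ ContinuousOn U (Icc a b) ∧ U a = L ∧ U b = R ∧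
  ∀ ξ ∈ Ioo a b,
    (0 < (U ξ).1 ∧ (U ξ).1 < ρs) ∧ charSpeed γ ρs ε k (U ξ) = ξ ∧
    ∀ t x : ℝ, 0 < t → x / t = ξ →
      SolvesEulerAt γ ρs ε (fun s y => (U (y / s)).1) (fun s y => (U (y / s)).2) t x

/-- The nature of a wave. -/
inductive WaveKind
  | shock
  | rarefaction

/-- `U` has on `[a, b]` a wave of family `k` and nature `w` joining `L` to `R`
(a shock occupies the single ray `a = b`). -/
def IsWave (γ ρs ε : ℝ) (k : Family) (w : WaveKind) (U : ℝ → ℝ × ℝ) (a b : ℝ) (L R : ℝ × ℝ) :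
    Prop :=
  match w with
  | .shock => a = b ∧ IsShock γ ρs ε k a L R
  | .rarefaction => IsRarefaction γ ρs ε k U a b L R

/-- `IsFan U r c v`: to the right of `c` the profile `U` consists of finitely many constant states
separated by shock or rarefaction waves (of any family, in any number), the first constant state
being `v` and the last one `r`. -/
inductive IsFan (γ ρs ε : ℝ) (U : ℝ → ℝ × ℝ) (r : ℝ × ℝ) : ℝ → ℝ × ℝ → Prop
  | const (c : ℝ) (h : ∀ ξ, c < ξ → U ξ = r) : IsFan γ ρs ε U r c r
  | wave (c a b : ℝ) (v v' : ℝ × ℝ) (k : Family) (w : WaveKind) (hca : c < a)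
      (h : ∀ ξ ∈ Ioo c a, U ξ = v) (hw : IsWave γ ρs ε k w U a b v v')
      (hf : IsFan γ ρs ε U r b v') : IsFan γ ρs ε U r c v

/-- `(t, x) ↦ U (x / t)` is a solution, for `t > 0`, of the Riemann problem with left state `l` and
right state `r`: it is made of finitely many constant states separated by rarefaction waves and
entropic shock waves; it equals `l` for `x/t` near `-∞` and `r` for `x/t` near `+∞`, hence its
initial values are `l` on `x < 0` and `r` on `x > 0`. -/
def IsRiemannSolution (γ ρs ε : ℝ) (l r : ℝ × ℝ) (U : ℝ → ℝ × ℝ) : Prop :=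
  ∃ c : ℝ, (∀ ξ, ξ ≤ c → U ξ = l) ∧ IsFan γ ρs ε U r c l

/-- `U` consists of exactly the three constant states `l`, `m`, `r`, with a wave of the first family
and of nature `w₁` between `l` and `m`, and a wave of the second family and of nature `w₂`
between `m` and `r`. -/
def HasForm (γ ρs ε : ℝ) (l r : ℝ × ℝ) (w₁ w₂ : WaveKind) (m : ℝ × ℝ) (U : ℝ → ℝ × ℝ) : Prop :=
  ∃ a₁ b₁ a₂ b₂ : ℝ, a₁ ≤ b₁ ∧ b₁ < a₂ ∧ a₂ ≤ b₂ ∧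
    (∀ ξ, ξ < a₁ → U ξ = l) ∧
    IsWave γ ρs ε .first w₁ U a₁ b₁ l m ∧
    (∀ ξ ∈ Ioo b₁ a₂, U ξ = m) ∧
    IsWave γ ρs ε .second w₂ U a₂ b₂ m r ∧
    (∀ ξ, b₂ < ξ → U ξ = r)

/-- The Riemann problem has a solution, and all its solutions have the given form with the given
intermediate state `m`. -/
def RiemannSolvedBy (γ ρs ε : ℝ) (l r : ℝ × ℝ) (w₁ w₂ : WaveKind) (m : ℝ × ℝ) : Prop :=
  (∃ U, IsRiemannSolution γ ρs ε l r U) ∧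
  ∀ U, IsRiemannSolution γ ρs ε l r U → HasForm γ ρs ε l r w₁ w₂ m U

/-- The curve on which the states that a wave of nature `w` and family `k` joins to `v` are sought:
the integral curve for a rarefaction, the Hugoniot curve for a shock. -/
def waveCurve (γ ρs ε : ℝ) (k : Family) (w : WaveKind) (v : ℝ × ℝ) (ρ : ℝ) : ℝ :=
  match w with
  | .shock => hugoniotCurve γ ρs ε k v ρ
  | .rarefaction => integralCurve γ ρs ε k v ρ

/-- `m` is the intersection point of the graphs of `f` and `g` over `[0, ρ*)`. All the curves
considered here pass through the vacuum `(0, 0)`: `m` is the only intersection point of positive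
density if there is one, and `m` may be the vacuum only if there is none. -/
def IsIntersectionPoint (ρs : ℝ) (f g : ℝ → ℝ) (m : ℝ × ℝ) : Prop :=
  0 ≤ m.1 ∧ m.1 < ρs ∧ m.2 = f m.1 ∧ m.2 = g m.1 ∧
  ∀ ρ, 0 < ρ → ρ < ρs → f ρ = g ρ → ρ = m.1

/-- The Riemann problem is solved by a 1-wave of nature `w₁` and a 2-wave of nature `w₂`, and the
intermediate state `m` is the intersection point of the 1-curve of the corresponding kind issued
from `l` and the 2-curve of the corresponding kind issued from `r`. -/
def SolvedByCurves (γ ρs ε : ℝ) (l r : ℝ × ℝ) (w₁ w₂ : WaveKind) (m : ℝ × ℝ) : Prop :=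
  RiemannSolvedBy γ ρs ε l r w₁ w₂ m ∧
  IsIntersectionPoint ρs (waveCurve γ ρs ε .first w₁ l) (waveCurve γ ρs ε .second w₂ r) m

end

/-! Write `u = q/ρ`, `τ = 1/ρ` and `Z` for the impedance `ρ√p'`, so that `dp = -Z² dτ` and `dP = -Z
dτ`. In velocity variables the 1-curves from `l` read `u = u_l - J(ρ_l, ρ)` and the 2-curves from
`r` read `u = u_r + J(ρ_r, ρ)`, with the same function `J` (`velocityJump`). Intersecting two curves
therefore means solving the scalar equation `J(ρ_l, ρ) + J(ρ_r, ρ) = D`, where `D = u_l - u_r`. Each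
`J` is strictly increasing in `ρ`.

Since `Z` increases with density, Lax's condition forces the density to increase from the outer
state to the inner state of a shock, while along a rarefaction it decreases. Moreover, 1-waves
travel slower than the fluid on both sides, and 2-waves faster (`IsWave.first_spec`,
`IsWave.second_spec`). A solution is thus at most a 1-wave followed by a 2-wave. Joining the
rarefaction branch of `J` (inner density below the outer one) to its shock branch (above) gives an
increasing `compositeJump`. Hence at most one intermediate density is possible, and its position
relative to `ρ_l` and `ρ_r` decides the nature of both waves (`solvedByCurves_of_density`). If `D`
lies strictly below all values of the sum of the rarefaction jumps, the intermediate state is the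
vacuum (`solvedByCurves_vacuum`).

It remains to locate the root by the intermediate value theorem. The sign conditions on the Hugoniot
curves compare `D` with the shock jump between the two outer densities. For `u_l < u_r` in the
limit, `D` stays negative while `√ε P` tends to zero at both states
(`tendsto_sqrt_mul_soundPotential`), even when they become congested: boundedness of `ε p` suffices,
because `P` is bounded by a power of `p` of exponent less than `1/2`. -/

/-! ### Impedance, pressure and the two potentials. -/

/-- The acoustic impedance `ρ √p'(ρ)`. -/
noncomputable def impedance (γ ρs ρ : ℝ) : ℝ := √γ * (1 / ρ - 1 / ρs) ^ (-((γ + 1) / 2))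

/-- The potential `P + √p'`, whose variation along an integral curve is that of the
characteristic speed. -/
noncomputable def speedPotential (γ ρs ρ : ℝ) : ℝ := soundPotential γ ρs ρ + impedance γ ρs ρ / ρ

lemma specificVolume_excess_pos {ρs ρ : ℝ} (hρ : ρ ∈ Ioo 0 ρs) : 0 < 1 / ρ - 1 / ρs :=
  sub_pos.2 (one_div_lt_one_div_of_lt hρ.1 hρ.2)

lemma hasDerivAt_specificVolume_excess {ρs ρ : ℝ} (hρ : ρ ≠ 0) :
    HasDerivAt (fun x : ℝ => 1 / x - 1 / ρs) (-(1 / ρ ^ 2)) ρ := by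
  have := (hasDerivAt_inv hρ).sub_const (1 / ρs)
  simpa [one_div] using this

lemma impedance_pos {γ ρs ρ : ℝ} (hγ : 0 < γ) (hρ : ρ ∈ Ioo 0 ρs) : 0 < impedance γ ρs ρ :=
  mul_pos (Real.sqrt_pos.2 hγ) (Real.rpow_pos_of_pos (specificVolume_excess_pos hρ) _)

lemma impedance_sq {γ ρs ρ : ℝ} (hγ : 0 < γ) (hρ : ρ ∈ Ioo 0 ρs) :
    impedance γ ρs ρ ^ 2 = γ * (1 / ρ - 1 / ρs) ^ (-γ - 1) := by
  have hw := specificVolume_excess_pos hρ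
  rw [impedance, mul_pow, Real.sq_sqrt hγ.le, ← Real.rpow_mul_natCast hw.le]
  congr 2
  push_cast
  ring

lemma pressure_eq {γ ρs ρ : ℝ} (hρ : ρ ∈ Ioo 0 ρs) :
    pressure γ ρs ρ = (1 / ρ - 1 / ρs) ^ (-γ) := by
  rw [pressure, Real.rpow_neg (specificVolume_excess_pos hρ).le, one_div ((_ : ℝ) ^ γ)]

lemma hasDerivAt_pressure {γ ρs ρ : ℝ} (hγ : 0 < γ) (hρ : ρ ∈ Ioo 0 ρs) :
    HasDerivAt (pressure γ ρs) (impedance γ ρs ρ ^ 2 / ρ ^ 2) ρ := by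
  have hw := specificVolume_excess_pos hρ
  have h := (hasDerivAt_specificVolume_excess (ρs := ρs) hρ.1.ne').rpow_const (p := -γ)
    (Or.inl hw.ne')
  refine (h.congr_of_eventuallyEq ?_).congr_deriv ?_
  · filter_upwards [Ioo_mem_nhds hρ.1 hρ.2] with x hx using pressure_eq hx
  · rw [impedance_sq hγ hρ]; ring

lemma sqrt_deriv_pressure {γ ρs ρ : ℝ} (hγ : 0 < γ) (hρ : ρ ∈ Ioo 0 ρs) :
    √(deriv (pressure γ ρs) ρ) = impedance γ ρs ρ / ρ := by
  rw [(hasDerivAt_pressure hγ hρ).deriv, ← div_pow,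
    Real.sqrt_sq (div_pos (impedance_pos hγ hρ) hρ.1).le]

lemma charSpeed_eq {γ ρs ε : ℝ} {v : ℝ × ℝ} (k : Family) (hγ : 0 < γ) (hε : 0 < ε)
    (hv : v.1 ∈ Ioo 0 ρs) :
    charSpeed γ ρs ε k v = v.2 / v.1 + k.sgn * (√ε * (impedance γ ρs v.1 / v.1)) := by
  rw [charSpeed, Real.sqrt_mul hε.le, sqrt_deriv_pressure hγ hv]

lemma exists_hasDerivAt_impedance {γ ρs ρ : ℝ} (hγ : 0 < γ) (hρ : ρ ∈ Ioo 0 ρs) :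
    ∃ d, 0 < d ∧ HasDerivAt (impedance γ ρs) d ρ := by
  have hw := specificVolume_excess_pos hρ
  have h := ((hasDerivAt_specificVolume_excess (ρs := ρs) hρ.1.ne').rpow_const
    (p := -((γ + 1) / 2)) (Or.inl hw.ne')).const_mul √γ
  refine ⟨_, ?_, h⟩
  have h1 := Real.rpow_pos_of_pos hw (-((γ + 1) / 2) - 1)
  have h2 := Real.sqrt_pos.2 hγ
  have h3 : 0 < 1 / ρ ^ 2 := by have := hρ.1; positivity
  rw [neg_mul_neg]
  positivity

lemma continuousOn_impedance {γ ρs : ℝ} (hγ : 0 < γ) :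
    ContinuousOn (impedance γ ρs) (Ioo 0 ρs) := fun _ hρ =>
  let ⟨_, _, h⟩ := exists_hasDerivAt_impedance hγ hρ
  h.continuousAt.continuousWithinAt

/-- A function with positive derivative on an open interval is strictly increasing there. -/
lemma strictMonoOn_Ioo_of_hasDerivAt_pos {f f' : ℝ → ℝ} {a b : ℝ}
    (hf : ∀ x ∈ Ioo a b, HasDerivAt f (f' x) x) (hf' : ∀ x ∈ Ioo a b, 0 < f' x) :
    StrictMonoOn f (Ioo a b) := by
  refine strictMonoOn_of_deriv_pos (convex_Ioo a b)
    (fun x hx => (hf x hx).continuousAt.continuousWithinAt) fun x hx => ?_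
  rw [interior_Ioo] at hx
  rw [(hf x hx).deriv]
  exact hf' x hx

lemma strictMonoOn_impedance {γ ρs : ℝ} (hγ : 0 < γ) :
    StrictMonoOn (impedance γ ρs) (Ioo 0 ρs) := by
  refine strictMonoOn_of_deriv_pos (convex_Ioo 0 ρs) (continuousOn_impedance hγ) fun x hx => ?_
  rw [interior_Ioo] at hx
  obtain ⟨d, hd, h⟩ := exists_hasDerivAt_impedance hγ hx
  rwa [h.deriv]

lemma strictMonoOn_pressure {γ ρs : ℝ} (hγ : 0 < γ) :
    StrictMonoOn (pressure γ ρs) (Ioo 0 ρs) :=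
  strictMonoOn_Ioo_of_hasDerivAt_pos (fun _ hx => hasDerivAt_pressure hγ hx) fun _ hx =>
    div_pos (pow_pos (impedance_pos hγ hx) 2) (pow_pos hx.1 2)

lemma continuousOn_pressure {γ ρs : ℝ} (hγ : 0 < γ) :
    ContinuousOn (pressure γ ρs) (Ioo 0 ρs) := fun _ hρ =>
  (hasDerivAt_pressure hγ hρ).continuousAt.continuousWithinAt

lemma hasDerivAt_soundPotential {γ ρs ρ : ℝ} (hγ : 0 < γ) (hρ : ρ ∈ Ioo 0 ρs) :
    HasDerivAt (soundPotential γ ρs) (impedance γ ρs ρ / ρ ^ 2) ρ := by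
  have hc : ContinuousOn (fun s => √(deriv (pressure γ ρs) s) / s) (Ioo 0 ρs) := by
    have : ContinuousOn (fun s => impedance γ ρs s / s / s) (Ioo 0 ρs) :=
      ((continuousOn_impedance hγ).div continuousOn_id fun x hx => hx.1.ne').div continuousOn_id
        fun x hx => hx.1.ne'
    exact this.congr fun x hx => by simp only [sqrt_deriv_pressure hγ hx]
  have hmid : ρs / 2 ∈ Ioo 0 ρs := by
    have := hρ.1.trans hρ.2
    constructor <;> linarith
  have hsub : uIcc (ρs / 2) ρ ⊆ Ioo 0 ρs := ordConnected_Ioo.uIcc_subset hmid hρ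
  have h := intervalIntegral.integral_hasDerivAt_right
    (hc.mono hsub).intervalIntegrable
    (hc.stronglyMeasurableAtFilter isOpen_Ioo ρ hρ)
    (hc.continuousAt (Ioo_mem_nhds hρ.1 hρ.2))
  refine h.congr_deriv ?_
  rw [sqrt_deriv_pressure hγ hρ, div_div, sq]

lemma continuousOn_soundPotential {γ ρs : ℝ} (hγ : 0 < γ) :
    ContinuousOn (soundPotential γ ρs) (Ioo 0 ρs) := fun _ hρ =>
  (hasDerivAt_soundPotential hγ hρ).continuousAt.continuousWithinAt

lemma strictMonoOn_soundPotential {γ ρs : ℝ} (hγ : 0 < γ) :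
    StrictMonoOn (soundPotential γ ρs) (Ioo 0 ρs) :=
  strictMonoOn_Ioo_of_hasDerivAt_pos (fun _ hx => hasDerivAt_soundPotential hγ hx) fun _ hx =>
    div_pos (impedance_pos hγ hx) (pow_pos hx.1 2)

/-- Genuine nonlinearity: the terms in `Z/ρ²` cancel, which leaves `Z'/ρ > 0`. -/
lemma exists_hasDerivAt_speedPotential {γ ρs ρ : ℝ} (hγ : 0 < γ) (hρ : ρ ∈ Ioo 0 ρs) :
    ∃ d, 0 < d ∧ HasDerivAt (speedPotential γ ρs) d ρ := by
  obtain ⟨d, hd, h⟩ := exists_hasDerivAt_impedance hγ hρ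
  have hρ0 := hρ.1
  refine ⟨d / ρ, by positivity, ?_⟩
  refine ((hasDerivAt_soundPotential hγ hρ).add
    (h.div (hasDerivAt_id ρ) hρ0.ne')).congr_deriv ?_
  simp only [id]
  field_simp
  ring

lemma continuousOn_speedPotential {γ ρs : ℝ} (hγ : 0 < γ) :
    ContinuousOn (speedPotential γ ρs) (Ioo 0 ρs) := fun _ hρ =>
  let ⟨_, _, h⟩ := exists_hasDerivAt_speedPotential hγ hρ
  h.continuousAt.continuousWithinAt

lemma strictMonoOn_speedPotential {γ ρs : ℝ} (hγ : 0 < γ) :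
    StrictMonoOn (speedPotential γ ρs) (Ioo 0 ρs) := by
  refine strictMonoOn_of_deriv_pos (convex_Ioo 0 ρs) (continuousOn_speedPotential hγ)
    fun x hx => ?_
  rw [interior_Ioo] at hx
  obtain ⟨d, hd, h⟩ := exists_hasDerivAt_speedPotential hγ hx
  rwa [h.deriv]

lemma soundPotential_lt_speedPotential {γ ρs ρ : ℝ} (hγ : 0 < γ) (hρ : ρ ∈ Ioo 0 ρs) :
    soundPotential γ ρs ρ < speedPotential γ ρs ρ :=
  lt_add_of_pos_right _ (div_pos (impedance_pos hγ hρ) hρ.1)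

/-! ### Comparison in specific volume, and behaviour near vacuum and congestion. -/

/-- If `f' = g / ρ²` with `g` strictly increasing, then the slope of `f` with respect to the
specific volume lies between the values of `g`. -/
lemma slope_specificVolume_bounds {f g : ℝ → ℝ} {ρs a b : ℝ}
    (hf : ∀ x ∈ Ioo 0 ρs, HasDerivAt f (g x / x ^ 2) x) (hg : StrictMonoOn g (Ioo 0 ρs))
    (ha : 0 < a) (hab : a < b) (hb : b < ρs) :
    g a * (1 / a - 1 / b) < f b - f a ∧ f b - f a < g b * (1 / a - 1 / b) := by
  have key : ∀ c x, x ∈ Ioo 0 ρs → HasDerivAt (fun x => f x + c * (1 / x))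
      ((g x - c) / x ^ 2) x := fun c x hx => by
    have h := (hf x hx).add ((hasDerivAt_inv hx.1.ne').const_mul c)
    simp only [one_div]
    exact h.congr_deriv (by ring)
  have hIcc : Icc a b ⊆ Ioo 0 ρs := fun x hx => ⟨ha.trans_le hx.1, hx.2.trans_lt hb⟩
  have haI := hIcc (left_mem_Icc.2 hab.le)
  have hbI := hIcc (right_mem_Icc.2 hab.le)
  constructor
  · have := strictMonoOn_of_deriv_pos (convex_Icc a b) (f := fun x => f x + g a * (1 / x))
      (fun x hx => (key _ x (hIcc hx)).continuousAt.continuousWithinAt) (fun x hx => by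
        have hx' := interior_subset hx
        rw [interior_Icc] at hx
        rw [(key _ x (hIcc hx')).deriv]
        exact div_pos (sub_pos.2 (hg haI (hIcc hx') hx.1)) (pow_pos (hIcc hx').1 2))
      (left_mem_Icc.2 hab.le) (right_mem_Icc.2 hab.le) hab
    simp only at this
    linarith
  · have := strictAntiOn_of_deriv_neg (convex_Icc a b) (f := fun x => f x + g b * (1 / x))
      (fun x hx => (key _ x (hIcc hx)).continuousAt.continuousWithinAt) (fun x hx => by
        have hx' := interior_subset hx
        rw [interior_Icc] at hx
        rw [(key _ x (hIcc hx')).deriv]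
        exact div_neg_of_neg_of_pos (sub_neg.2 (hg (hIcc hx') hbI hx.2)) (pow_pos (hIcc hx').1 2))
      (left_mem_Icc.2 hab.le) (right_mem_Icc.2 hab.le) hab
    simp only at this
    linarith

lemma impedance_mul_lt_soundPotential_sub {γ ρs a b : ℝ} (hγ : 0 < γ) (ha : 0 < a) (hab : a < b)
    (hb : b < ρs) :
    impedance γ ρs a * (1 / a - 1 / b) < soundPotential γ ρs b - soundPotential γ ρs a :=
  (slope_specificVolume_bounds (fun _ hx => hasDerivAt_soundPotential hγ hx)
    (strictMonoOn_impedance hγ) ha hab hb).1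

/-- These are Lax's inequalities in disguise: the squared mass flux through a shock is `ε` times the
chord slope of `p` in specific volume. -/
lemma pressure_sub_bounds {γ ρs a b : ℝ} (hγ : 0 < γ) (ha : 0 < a) (hab : a < b)
    (hb : b < ρs) :
    impedance γ ρs a ^ 2 * (1 / a - 1 / b) < pressure γ ρs b - pressure γ ρs a ∧
    pressure γ ρs b - pressure γ ρs a < impedance γ ρs b ^ 2 * (1 / a - 1 / b) :=
  slope_specificVolume_bounds (fun _ hx => hasDerivAt_pressure hγ hx)
    (fun _ hx _ hy hxy => pow_lt_pow_left₀ (strictMonoOn_impedance hγ hx hy hxy)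
      (impedance_pos hγ hx).le two_ne_zero) ha hab hb

lemma exists_density_of_excess {ρs w : ℝ} (hρs : 0 < ρs) (hw : 0 < w) :
    ∃ ρ ∈ Ioo 0 ρs, 1 / ρ - 1 / ρs = w := by
  have h1 : 0 < 1 / ρs := by positivity
  refine ⟨1 / (w + 1 / ρs), ⟨by positivity, ?_⟩, by rw [one_div_one_div]; ring⟩
  rw [div_lt_iff₀ (by positivity), mul_add, mul_one_div_cancel hρs.ne']
  nlinarith

/-- Near the vacuum the two potentials have the same limit. -/
lemma exists_speedPotential_lt_soundPotential {γ ρs m : ℝ} (hγ : 0 < γ) (hm : m ∈ Ioo 0 ρs) :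
    ∃ ρ ∈ Ioo 0 m, speedPotential γ ρs ρ < soundPotential γ ρs m := by
  have hρs := hm.1.trans hm.2
  have hwm := specificVolume_excess_pos hm
  set wm := 1 / m - 1 / ρs with hwm_def
  have hi : 0 < 1 / ρs := by positivity
  have hs : (1.4 : ℝ) < √2 := Real.lt_sqrt_of_sq_lt (by norm_num)
  have hs' : √2 < (1.5 : ℝ) := (Real.sqrt_lt' (by norm_num)).2 (by norm_num)
  -- The single bound `Z(ρ)(1/ρ - 1/m)` falls short of `Z(ρ)/ρ`. An intermediate density with half
  -- the excess gains a factor `√2` in `Z`; in units of `Z(ρ)` the two bounds add up to at least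
  -- `22.6 wm + 12/ρs`, against `20 wm + 11/ρs` for `1/ρ`.
  obtain ⟨ρ, hρ, hwρ⟩ := exists_density_of_excess hρs
    (w := 10 * (2 * wm + 1 / ρs)) (by positivity)
  obtain ⟨ρ', hρ', hwρ'⟩ := exists_density_of_excess hρs
    (w := 5 * (2 * wm + 1 / ρs)) (by positivity)
  have h1 : ρ < ρ' := lt_of_one_div_lt_one_div hρ'.1 (by linarith)
  have h2 : ρ' < m := lt_of_one_div_lt_one_div hm.1 (by linarith)
  refine ⟨ρ, ⟨hρ.1, h1.trans h2⟩, ?_⟩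
  have b1 := impedance_mul_lt_soundPotential_sub hγ hρ.1 h1 hρ'.2
  have b2 := impedance_mul_lt_soundPotential_sub hγ hρ'.1 h2 hm.2
  have hZ : √2 * impedance γ ρs ρ ≤ impedance γ ρs ρ' := by
    rw [impedance, impedance, hwρ, hwρ', show 10 * (2 * wm + 1 / ρs) = 2 * (5 * (2 * wm + 1 / ρs))
      by ring, Real.mul_rpow (by norm_num) (by positivity)]
    have : √2 * (2 : ℝ) ^ (-((γ + 1) / 2)) ≤ 1 := by
      rw [Real.sqrt_eq_rpow, ← Real.rpow_add (by norm_num)]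
      exact Real.rpow_le_one_of_one_le_of_nonpos (by norm_num) (by linarith)
    have h0 : 0 ≤ √γ * (5 * (2 * wm + 1 / ρs)) ^ (-((γ + 1) / 2)) := by positivity
    calc _ = (√2 * (2 : ℝ) ^ (-((γ + 1) / 2))) *
        (√γ * (5 * (2 * wm + 1 / ρs)) ^ (-((γ + 1) / 2))) := by ring
      _ ≤ _ := mul_le_of_le_one_left h0 this
  have hZρ := impedance_pos hγ hρ
  have e1 : 1 / ρ - 1 / ρ' = 5 * (2 * wm + 1 / ρs) := by linarith
  have e2 : 1 / ρ' - 1 / m = 9 * wm + 5 * (1 / ρs) := by linarith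
  rw [e1] at b1
  rw [e2] at b2
  have e3 : impedance γ ρs ρ / ρ = impedance γ ρs ρ * (20 * wm + 11 * (1 / ρs)) := by
    rw [div_eq_mul_one_div]; congr 1; linarith
  have b3 : 1.4 * impedance γ ρs ρ * (9 * wm + 5 * (1 / ρs)) ≤
      impedance γ ρs ρ' * (9 * wm + 5 * (1 / ρs)) := by
    refine mul_le_mul_of_nonneg_right (le_trans ?_ hZ) (by positivity)
    exact mul_le_mul_of_nonneg_right hs.le hZρ.le
  rw [speedPotential, e3]
  nlinarith [mul_pos hZρ hwm, mul_pos hZρ hi]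

lemma tendsto_specificVolume_excess {ρs : ℝ} (hρs : 0 < ρs) :
    Tendsto (fun ρ => 1 / ρ - 1 / ρs) (𝓝[<] ρs) (𝓝[>] 0) := by
  refine tendsto_nhdsWithin_iff.2 ⟨?_, ?_⟩
  · have : ContinuousAt (fun ρ : ℝ => 1 / ρ - 1 / ρs) ρs :=
      (hasDerivAt_specificVolume_excess hρs.ne').continuousAt
    simpa [ContinuousAt] using this.tendsto.mono_left nhdsWithin_le_nhds
  · filter_upwards [Ioo_mem_nhdsLT hρs] with x hx using specificVolume_excess_pos hx

lemma tendsto_pressure_atTop {γ ρs : ℝ} (hγ : 0 < γ) (hρs : 0 < ρs) :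
    Tendsto (pressure γ ρs) (𝓝[<] ρs) atTop := by
  refine ((tendsto_rpow_neg_nhdsGT_zero (neg_neg_of_pos hγ)).comp
    (tendsto_specificVolume_excess hρs)).congr' ?_
  filter_upwards [Ioo_mem_nhdsLT hρs] with x hx using (pressure_eq hx).symm

lemma tendsto_speedPotential_atTop {γ ρs : ℝ} (hγ : 0 < γ) (hρs : 0 < ρs) :
    Tendsto (speedPotential γ ρs) (𝓝[<] ρs) atTop := by
  have h1 : Tendsto (impedance γ ρs) (𝓝[<] ρs) atTop :=
    ((tendsto_rpow_neg_nhdsGT_zero (by linarith)).comp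
      (tendsto_specificVolume_excess hρs)).const_mul_atTop (Real.sqrt_pos.2 hγ)
  have h2 := tendsto_atTop_add_const_left _ (soundPotential γ ρs (ρs / 2))
    (h1.const_mul_atTop (show 0 < 1 / ρs by positivity))
  refine tendsto_atTop_mono' _ ?_ h2
  filter_upwards [Ioo_mem_nhdsLT (show ρs / 2 < ρs by linarith)] with x hx
  have hx' : x ∈ Ioo 0 ρs := ⟨by linarith [hx.1], hx.2⟩
  refine add_le_add ((strictMonoOn_soundPotential hγ).monotoneOn ⟨by linarith, by linarith⟩ hx'
    hx.1.le) ?_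
  rw [← one_div_mul_eq_div x]
  exact mul_le_mul_of_nonneg_right (one_div_le_one_div_of_le hx'.1 hx.2.le)
    (impedance_pos hγ hx').le

/-! ### Velocity jumps along the wave curves. -/

/-- The velocity jump between the densities `a` and `ρ` along a wave curve of the given nature
issued from density `a`, up to the sign of the family. -/
noncomputable def velocityJump (γ ρs ε : ℝ) (w : WaveKind) (a ρ : ℝ) : ℝ :=
  match w with
  | .shock => Real.sign (ρ - a) *
      √((ρ - a) * (ε * pressure γ ρs ρ - ε * pressure γ ρs a) / (ρ * a))
  | .rarefaction => √ε * (soundPotential γ ρs ρ - soundPotential γ ρs a)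

lemma waveCurve_zero (γ ρs ε : ℝ) (k : Family) (w : WaveKind) (v : ℝ × ℝ) :
    waveCurve γ ρs ε k w v 0 = 0 := by
  cases w <;> simp [waveCurve, hugoniotCurve, integralCurve]

lemma waveCurve_eq {γ ρs ε ρ : ℝ} (k : Family) (w : WaveKind) {v : ℝ × ℝ} (hv : 0 < v.1)
    (hρ : 0 < ρ) :
    waveCurve γ ρs ε k w v ρ = ρ * (v.2 / v.1 + k.sgn * velocityJump γ ρs ε w v.1 ρ) := by
  cases w
  · simp only [waveCurve, hugoniotCurve, velocityJump]
    have h : √(ρ / v.1) = ρ * √(1 / (ρ * v.1)) := by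
      rw [show ρ / v.1 = ρ ^ 2 * (1 / (ρ * v.1)) by field_simp, Real.sqrt_mul (by positivity),
        Real.sqrt_sq hρ.le]
    rw [h, mul_assoc ρ, ← Real.sqrt_mul (by positivity), one_div_mul_eq_div]
    ring
  · simp only [waveCurve, integralCurve, velocityJump]
    ring

lemma shockStrength_eq {γ ρs ε a ρ : ℝ} (ha : 0 < a) (hρ : 0 < ρ) :
    (ρ - a) * (ε * pressure γ ρs ρ - ε * pressure γ ρs a) / (ρ * a) =
      ε * ((1 / a - 1 / ρ) * (pressure γ ρs ρ - pressure γ ρs a)) := by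
  field_simp

lemma velocityJump_shock_of_le {γ ρs ε a ρ : ℝ} (ha : 0 < a) (h : a ≤ ρ) :
    velocityJump γ ρs ε .shock a ρ =
      √(ε * ((1 / a - 1 / ρ) * (pressure γ ρs ρ - pressure γ ρs a))) := by
  simp only [velocityJump]
  rw [shockStrength_eq ha (ha.trans_le h)]
  rcases h.eq_or_lt with rfl | h
  · simp
  · rw [Real.sign_of_pos (sub_pos.2 h), one_mul]

lemma velocityJump_shock_of_ge {γ ρs ε a ρ : ℝ} (hρ : 0 < ρ) (h : ρ ≤ a) :
    velocityJump γ ρs ε .shock a ρ =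
      -√(ε * ((1 / ρ - 1 / a) * (pressure γ ρs a - pressure γ ρs ρ))) := by
  simp only [velocityJump]
  rw [shockStrength_eq (hρ.trans_le h) hρ, show (1 / a - 1 / ρ) * (pressure γ ρs ρ -
    pressure γ ρs a) = (1 / ρ - 1 / a) * (pressure γ ρs a - pressure γ ρs ρ) by ring]
  rcases h.eq_or_lt with rfl | h
  · simp
  · rw [Real.sign_of_neg (sub_neg.2 h), neg_one_mul]

lemma velocityJump_self (γ ρs ε : ℝ) (w : WaveKind) (a : ℝ) :
    velocityJump γ ρs ε w a a = 0 := by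
  cases w <;> simp [velocityJump]

lemma strictMonoOn_velocityJump {γ ρs ε a : ℝ} (w : WaveKind) (hγ : 0 < γ) (hε : 0 < ε)
    (ha : a ∈ Ioo 0 ρs) : StrictMonoOn (velocityJump γ ρs ε w a) (Ioo 0 ρs) := by
  cases w
  · have hp := strictMonoOn_pressure (ρs := ρs) hγ
    have h1 : StrictMonoOn (velocityJump γ ρs ε .shock a) (Ioc 0 a) := fun x hx y hy hxy => by
      have hxI : x ∈ Ioo 0 ρs := ⟨hx.1, hx.2.trans_lt ha.2⟩
      have hyI : y ∈ Ioo 0 ρs := ⟨hy.1, hy.2.trans_lt ha.2⟩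
      rw [velocityJump_shock_of_ge hx.1 hx.2, velocityJump_shock_of_ge hy.1 hy.2, neg_lt_neg_iff]
      have p1 := hp hxI hyI hxy
      have p2 := hp.monotoneOn hyI ha hy.2
      have t1 := one_div_lt_one_div_of_lt hx.1 hxy
      have t2 := one_div_le_one_div_of_le hy.1 hy.2
      refine Real.sqrt_lt_sqrt (mul_nonneg hε.le (mul_nonneg (by linarith) (by linarith)))
        (mul_lt_mul_of_pos_left ?_ hε)
      exact mul_lt_mul'' (by linarith) (by linarith) (by linarith) (by linarith)
    have h2 : StrictMonoOn (velocityJump γ ρs ε .shock a) (Ico a ρs) := fun x hx y hy hxy => by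
      have hxI : x ∈ Ioo 0 ρs := ⟨ha.1.trans_le hx.1, hx.2⟩
      have hyI : y ∈ Ioo 0 ρs := ⟨ha.1.trans_le hy.1, hy.2⟩
      rw [velocityJump_shock_of_le ha.1 hx.1, velocityJump_shock_of_le ha.1 hy.1]
      have p1 := hp hxI hyI hxy
      have p2 := hp.monotoneOn ha hxI hx.1
      have t1 := one_div_lt_one_div_of_lt hxI.1 hxy
      have t2 := one_div_le_one_div_of_le ha.1 hx.1
      refine Real.sqrt_lt_sqrt (mul_nonneg hε.le (mul_nonneg (by linarith) (by linarith)))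
        (mul_lt_mul_of_pos_left ?_ hε)
      exact mul_lt_mul'' (by linarith) (by linarith) (by linarith) (by linarith)
    have h := h1.union h2 (isGreatest_Ioc ha.1) (isLeast_Ico ha.2)
    rwa [Ioc_union_Ico_eq_Ioo ha.1 ha.2] at h
  · exact fun x hx y hy hxy => mul_lt_mul_of_pos_left
      (sub_lt_sub_right (strictMonoOn_soundPotential hγ hx hy hxy) _) (Real.sqrt_pos.2 hε)

lemma continuousOn_velocityJump_shock {γ ρs ε a : ℝ} (hγ : 0 < γ) (ha : 0 < a) :
    ContinuousOn (velocityJump γ ρs ε .shock a) (Ico a ρs) := by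
  have h : ContinuousOn (fun ρ => √(ε * ((1 / a - 1 / ρ) *
      (pressure γ ρs ρ - pressure γ ρs a)))) (Ico a ρs) := by
    refine (continuousOn_const.mul (ContinuousOn.mul ?_ ?_)).sqrt
    · exact continuousOn_const.sub (continuousOn_const.div continuousOn_id
        fun x hx => (ha.trans_le hx.1).ne')
    · exact ((continuousOn_pressure hγ).mono fun x hx => ⟨ha.trans_le hx.1, hx.2⟩).sub
        continuousOn_const
  exact h.congr fun x hx => velocityJump_shock_of_le ha hx.1

lemma continuousOn_velocityJump_rarefaction {γ ρs ε a : ℝ} (hγ : 0 < γ) :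
    ContinuousOn (velocityJump γ ρs ε .rarefaction a) (Ioo 0 ρs) :=
  continuousOn_const.mul ((continuousOn_soundPotential hγ).sub continuousOn_const)

lemma exists_lt_velocityJump_shock {γ ρs ε a : ℝ} (hγ : 0 < γ) (hε : 0 < ε)
    (ha : a ∈ Ioo 0 ρs) (K : ℝ) {b : ℝ} (hb : b < ρs) :
    ∃ ρ ∈ Ioo b ρs, a < ρ ∧ K < velocityJump γ ρs ε .shock a ρ := by
  have hρs := ha.1.trans ha.2
  -- For densities beyond a fixed `c > a`, the difference of specific volumes stays above `1/a -
  -- 1/c`, so the blow-up of the pressure alone makes the jump large.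
  obtain ⟨c, hc, hcs⟩ := exists_between (max_lt ha.2 hb)
  have hac : a < c := (le_max_left _ _).trans_lt hc
  have hbc : b < c := (le_max_right _ _).trans_lt hc
  have hd : 0 < ε * (1 / a - 1 / c) :=
    mul_pos hε (sub_pos.2 (one_div_lt_one_div_of_lt ha.1 hac))
  have h := ((tendsto_pressure_atTop hγ hρs).eventually_gt_atTop
    (K ^ 2 / (ε * (1 / a - 1 / c)) + pressure γ ρs a)).and (Ioo_mem_nhdsLT hcs)
  obtain ⟨ρ, hp, hcρ, hρs'⟩ := h.exists
  refine ⟨ρ, ⟨hbc.trans hcρ, hρs'⟩, hac.trans hcρ, ?_⟩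
  rw [velocityJump_shock_of_le ha.1 (hac.trans hcρ).le]
  refine (le_abs_self K).trans_lt (Real.lt_sqrt_of_sq_lt ?_)
  rw [sq_abs]
  have hp' : K ^ 2 / (ε * (1 / a - 1 / c)) < pressure γ ρs ρ - pressure γ ρs a := by linarith
  have h0 : 0 < pressure γ ρs ρ - pressure γ ρs a := lt_of_le_of_lt (by positivity) hp'
  rw [div_lt_iff₀ hd] at hp'
  have t := one_div_lt_one_div_of_lt (ha.1.trans hac) hcρ
  nlinarith [mul_pos (mul_pos hε h0) (sub_pos.2 t)]

/-! ### Reflection of space, and shocks of the first family. -/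

/-- The image of a state under the reflection `x ↦ -x`. -/
noncomputable def mirror (v : ℝ × ℝ) : ℝ × ℝ := (v.1, -v.2)

@[simp] lemma mirror_fst (v : ℝ × ℝ) : (mirror v).1 = v.1 := rfl

@[simp] lemma mirror_snd (v : ℝ × ℝ) : (mirror v).2 = -v.2 := rfl

@[simp] lemma mirror_mirror (v : ℝ × ℝ) : mirror (mirror v) = v := by simp [mirror]

lemma charSpeed_mirror {k k' : Family} (hk : k'.sgn = -k.sgn) (γ ρs ε : ℝ) (v : ℝ × ℝ) :
    charSpeed γ ρs ε k' (mirror v) = -charSpeed γ ρs ε k v := by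
  simp only [charSpeed, mirror, hk]; ring

lemma IsShock.mirror {γ ρs ε σ : ℝ} {k k' : Family} {L R : ℝ × ℝ} (hk : k'.sgn = -k.sgn)
    (h : IsShock γ ρs ε k σ L R) : IsShock γ ρs ε k' (-σ) (mirror R) (mirror L) := by
  simp only [IsShock, charSpeed_mirror hk, momentumFlux, mirror_fst, mirror_snd, neg_sq,
    neg_lt_neg_iff] at h ⊢
  obtain ⟨h1, h2, h3, h4, h5, h6⟩ := h
  exact ⟨h2, h1, by linarith, by linarith, h6, h5⟩

/-- The mass flux `j = ρ(u - σ)` is the same on both sides, and Lax's condition becomes `√ε Z(L) < j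
< √ε Z(R)`. Monotonicity of `Z` orders the densities, and `j > 0` makes the shock slower than the
fluid. The jump follows from `[u] = j[τ]` and `j[u] = -ε[p]`. -/
lemma IsShock.first_spec {γ ρs ε σ : ℝ} {L R : ℝ × ℝ} (hγ : 0 < γ) (hε : 0 < ε)
    (h : IsShock γ ρs ε .first σ L R) :
    L.1 < R.1 ∧ R.2 / R.1 = L.2 / L.1 - velocityJump γ ρs ε .shock L.1 R.1 ∧ σ < R.2 / R.1 := by
  obtain ⟨hL, hR, h3, h4, h5, h6⟩ := h
  obtain ⟨ρL, qL⟩ := L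
  obtain ⟨ρR, qR⟩ := R
  simp only at hL hR h3 h4 ⊢
  rw [charSpeed_eq _ hγ hε ⟨hR.1, hR.2⟩] at h5
  rw [charSpeed_eq _ hγ hε ⟨hL.1, hL.2⟩] at h6
  have hL0 := hL.1
  have hR0 := hR.1
  obtain ⟨uL, rfl⟩ : ∃ u, qL = ρL * u := ⟨qL / ρL, by field_simp⟩
  obtain ⟨uR, rfl⟩ : ∃ u, qR = ρR * u := ⟨qR / ρR, by field_simp⟩
  simp only [Family.sgn, momentumFlux, mul_div_cancel_left₀ _ hL0.ne',
    mul_div_cancel_left₀ _ hR0.ne'] at h4 h5 h6 ⊢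
  have hs := Real.sqrt_pos.2 hε
  obtain ⟨j, hj⟩ : ∃ j, j = ρL * (uL - σ) := ⟨_, rfl⟩
  have hj' : j = ρR * (uR - σ) := by linarith
  have hmom : j * (uL - uR) = ε * pressure γ ρs ρR - ε * pressure γ ρs ρL := by
    have e1 : (ρR * uR) ^ 2 / ρR = ρR * uR ^ 2 := by field_simp
    have e2 : (ρL * uL) ^ 2 / ρL = ρL * uL ^ 2 := by field_simp
    rw [e1, e2] at h4
    have : j * (uL - uR) = ρL * (uL - σ) * uL - ρR * (uR - σ) * uR := by
      rw [← hj, ← hj']; ring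
    rw [this]; linarith
  have hjL : √ε * impedance γ ρs ρL < j := by
    have : √ε * (impedance γ ρs ρL / ρL) < uL - σ := by linarith
    calc _ = ρL * (√ε * (impedance γ ρs ρL / ρL)) := by field_simp
      _ < _ := by rw [hj]; exact mul_lt_mul_of_pos_left this hL0
  have hjR : j < √ε * impedance γ ρs ρR := by
    have : uR - σ < √ε * (impedance γ ρs ρR / ρR) := by linarith
    calc j < ρR * (√ε * (impedance γ ρs ρR / ρR)) := by
          rw [hj']; exact mul_lt_mul_of_pos_left this hR0
      _ = _ := by field_simp
  have hj0 : 0 < j := (mul_pos hs (impedance_pos hγ ⟨hL.1, hL.2⟩)).trans hjL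
  have hlt : ρL < ρR := ((strictMonoOn_impedance hγ).lt_iff_lt ⟨hL.1, hL.2⟩ ⟨hR.1, hR.2⟩).1
    (lt_of_mul_lt_mul_left (hjL.trans hjR) hs.le)
  have hu : uL - uR = j * (1 / ρL - 1 / ρR) := by
    have e1 : uL = σ + j / ρL := by rw [hj]; field_simp; ring
    have e2 : uR = σ + j / ρR := by rw [hj']; field_simp; ring
    rw [e1, e2]; ring
  have ht := sub_pos.2 (one_div_lt_one_div_of_lt hL0 hlt)
  refine ⟨hlt, ?_, ?_⟩
  · rw [velocityJump_shock_of_le hL0 hlt.le, eq_sub_iff_add_eq, ← eq_sub_iff_add_eq', eq_comm,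
      eq_comm, Real.sqrt_eq_iff_mul_self_eq_of_pos (by rw [hu]; positivity)]
    nth_rewrite 1 [hu]
    calc _ = (1 / ρL - 1 / ρR) * (j * (uL - uR)) := by ring
      _ = _ := by rw [hmom]; ring
  · have : 0 < uR - σ := pos_of_mul_pos_right (hj' ▸ hj0) hR0.le
    linarith

/-- Conversely, the mass flux is taken to be `j = √(ε Δp/δτ)` and the speed `σ = u_L - j/ρ_L`; the
chord bounds of `pressure_sub_bounds` then give Lax's condition. -/
lemma exists_isShock_first {γ ρs ε : ℝ} {L R : ℝ × ℝ} (hγ : 0 < γ) (hε : 0 < ε)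
    (hL : 0 < L.1) (hlt : L.1 < R.1) (hR : R.1 < ρs)
    (h : R.2 / R.1 = L.2 / L.1 - velocityJump γ ρs ε .shock L.1 R.1) :
    ∃ σ, IsShock γ ρs ε .first σ L R := by
  obtain ⟨ρL, qL⟩ := L
  obtain ⟨ρR, qR⟩ := R
  simp only at hL hlt hR h
  have hR0 := hL.trans hlt
  obtain ⟨uL, rfl⟩ : ∃ u, qL = ρL * u := ⟨qL / ρL, by field_simp⟩
  obtain ⟨uR, rfl⟩ : ∃ u, qR = ρR * u := ⟨qR / ρR, by field_simp⟩
  rw [mul_div_cancel_left₀ _ hL.ne', mul_div_cancel_left₀ _ hR0.ne',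
    velocityJump_shock_of_le hL hlt.le] at h
  have ht := sub_pos.2 (one_div_lt_one_div_of_lt hL hlt)
  obtain ⟨b1, b2⟩ := pressure_sub_bounds hγ hL hlt hR
  set δ := 1 / ρL - 1 / ρR with hδ
  set Δ := pressure γ ρs ρR - pressure γ ρs ρL with hΔ
  have hΔ0 : 0 < Δ := lt_of_le_of_lt (by positivity) b1
  obtain ⟨j, hj⟩ : ∃ j, j = √(ε * (Δ / δ)) := ⟨_, rfl⟩
  have hj0 : 0 ≤ j := hj ▸ Real.sqrt_nonneg _
  have hjsq : j ^ 2 = ε * (Δ / δ) := by rw [hj, Real.sq_sqrt (by positivity)]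
  have hD : √(ε * (δ * Δ)) = j * δ := by
    rw [show ε * (δ * Δ) = (ε * (Δ / δ)) * δ ^ 2 by field_simp, Real.sqrt_mul (by positivity),
      Real.sqrt_sq ht.le, hj]
  have hmom : j * (j * δ) = ε * Δ := by
    rw [← mul_assoc, ← sq, hjsq]; field_simp
  rw [hD] at h
  have hZL := impedance_pos hγ (ρs := ρs) ⟨hL, hlt.trans hR⟩
  have hZR := impedance_pos hγ (ρs := ρs) ⟨hR0, hR⟩
  have hjL : √ε * impedance γ ρs ρL < j := by
    refine lt_of_pow_lt_pow_left₀ 2 hj0 ?_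
    rw [mul_pow, Real.sq_sqrt hε.le, hjsq]
    exact mul_lt_mul_of_pos_left ((lt_div_iff₀ ht).2 b1) hε
  have hjR : j < √ε * impedance γ ρs ρR := by
    refine lt_of_pow_lt_pow_left₀ 2 (by positivity) ?_
    rw [mul_pow, Real.sq_sqrt hε.le, hjsq]
    exact mul_lt_mul_of_pos_left ((div_lt_iff₀ ht).2 b2) hε
  have e1 : uL - (uL - j / ρL) = j / ρL := by ring
  have e2 : uR - (uL - j / ρL) = j / ρR := by rw [h, hδ]; ring
  have e1' : ρL * (uL - (uL - j / ρL)) = j := by rw [e1]; field_simp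
  have e2' : ρR * (uR - (uL - j / ρL)) = j := by rw [e2]; field_simp
  refine ⟨uL - j / ρL, ⟨hL, hlt.trans hR⟩, ⟨hR0, hR⟩, ?_, ?_, ?_, ?_⟩
  · simp only
    generalize uL - j / ρL = σ at *
    linarith
  · simp only [momentumFlux]
    rw [show (ρR * uR) ^ 2 / ρR = ρR * uR ^ 2 by field_simp,
      show (ρL * uL) ^ 2 / ρL = ρL * uL ^ 2 by field_simp]
    generalize uL - j / ρL = σ at *
    have hm : ε * pressure γ ρs ρR - ε * pressure γ ρs ρL = j * (uL - uR) := by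
      rw [← mul_sub, ← hΔ, ← hmom, h]; ring
    have : j * (uL - uR) = ρL * (uL - σ) * uL - ρR * (uR - σ) * uR := by rw [e1', e2']; ring
    linarith
  · rw [charSpeed_eq _ hγ hε ⟨hR0, hR⟩]
    simp only [Family.sgn, mul_div_cancel_left₀ _ hR0.ne']
    have : j / ρR < √ε * (impedance γ ρs ρR / ρR) := by
      rw [← mul_div_assoc]; exact div_lt_div_of_pos_right hjR hR0
    linarith
  · rw [charSpeed_eq _ hγ hε ⟨hL, hlt.trans hR⟩]
    simp only [Family.sgn, mul_div_cancel_left₀ _ hL.ne']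
    have : √ε * (impedance γ ρs ρL / ρL) < j / ρL := by
      rw [← mul_div_assoc]; exact div_lt_div_of_pos_right hjL hL
    linarith

/-! ### Rarefactions: differential form and necessary conditions. -/

/-- For profiles that follow a characteristic field, the system in a self-similar point reduces to
`q' = ξ ρ'`. -/
lemma isRarefaction_iff {γ ρs ε a b : ℝ} {k : Family} {U : ℝ → ℝ × ℝ} {L R : ℝ × ℝ}
    (hγ : 0 < γ) (hε : 0 < ε) :
    IsRarefaction γ ρs ε k U a b L R ↔
      a < b ∧ ContinuousOn U (Icc a b) ∧ U a = L ∧ U b = R ∧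
      ∀ ξ ∈ Ioo a b, (U ξ).1 ∈ Ioo 0 ρs ∧ charSpeed γ ρs ε k (U ξ) = ξ ∧
        ∃ d, HasDerivAt (fun y => (U y).1) d ξ ∧ HasDerivAt (fun y => (U y).2) (ξ * d) ξ := by
  refine and_congr_right fun hab => and_congr_right fun hc => and_congr_right fun _ =>
    and_congr_right fun _ => forall₂_congr fun ξ _ => ?_
  refine and_congr_right fun hρ => and_congr_right fun hξ => ?_
  constructor
  · intro h
    obtain ⟨ρt, ρx, qt, qx, fx, h1, h2, -, h4, -, h6, -⟩ := h 1 ξ one_pos (div_one ξ)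
    simp only [div_one] at h2 h4
    have h2' : HasDerivAt (fun y => (U y).1) ρx (ξ / 1) := by rwa [div_one]
    have h1' : HasDerivAt (fun s => (U (ξ / s)).1) (ρx * (-ξ)) 1 := by
      have hd : HasDerivAt (fun s : ℝ => ξ / s) (-ξ) 1 := by
        have := (hasDerivAt_inv (one_ne_zero (α := ℝ))).const_mul ξ
        simpa [div_eq_mul_inv] using this
      exact h2'.comp 1 hd
    have e := h1.unique h1'
    refine ⟨ρx, h2, ?_⟩
    convert h4 using 1
    linarith
  · rintro ⟨d, hd1, hd2⟩ t x ht rfl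
    have hx : HasDerivAt (fun y : ℝ => y / t) (1 / t) x := by
      simpa using (hasDerivAt_id x).div_const t
    have hs : HasDerivAt (fun s : ℝ => x / s) (-(x / t ^ 2)) t := by
      have := (hasDerivAt_inv ht.ne').const_mul x
      simp only [div_eq_mul_inv]
      exact this.congr_deriv (by ring)
    have e1 := hd1.comp x hx
    have e2 := hd2.comp x hx
    have hρ0 : (U (x / t)).1 ≠ 0 := hρ.1.ne'
    have e3 := ((e2.pow 2).div e1 hρ0).add
      (((hasDerivAt_pressure hγ hρ).comp x e1).const_mul ε)
    refine ⟨_, _, _, _, _, hd1.comp t hs, e1, hd2.comp t hs, e2, e3, ?_, ?_⟩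
    · field_simp; ring
    · rw [charSpeed_eq k hγ hε hρ] at hξ
      -- For either family `(ξ - u)² = ε p'`, and this identity turns `q' = ξρ'` into the momentum
      -- equation.
      have hk : k.sgn ^ 2 = 1 := by cases k <;> simp [Family.sgn]
      have hsq : (x / t - (U (x / t)).2 / (U (x / t)).1) ^ 2 =
          ε * (impedance γ ρs (U (x / t)).1 ^ 2 / (U (x / t)).1 ^ 2) := by
        nth_rewrite 1 [← hξ]
        rw [add_sub_cancel_left, mul_pow, mul_pow, hk, Real.sq_sqrt hε.le, div_pow, one_mul]
      simp only [Function.comp_apply, Pi.pow_apply] at e3 ⊢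
      generalize (U (x / t)).1 = ρ at *
      generalize (U (x / t)).2 = q at *
      generalize impedance γ ρs ρ ^ 2 / ρ ^ 2 = p' at *
      have : ε * (p' * (d * (1 / t))) = (x / t - q / ρ) ^ 2 * (d * (1 / t)) := by
        rw [hsq]; ring
      rw [this]
      field_simp
      ring

lemma IsRarefaction.mirror {γ ρs ε a b : ℝ} {k k' : Family} {U : ℝ → ℝ × ℝ} {L R : ℝ × ℝ}
    (hγ : 0 < γ) (hε : 0 < ε) (hk : k'.sgn = -k.sgn) (h : IsRarefaction γ ρs ε k U a b L R) :
    IsRarefaction γ ρs ε k' (fun ξ => mirror (U (-ξ))) (-b) (-a) (mirror R) (mirror L) := by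
  rw [isRarefaction_iff hγ hε] at h ⊢
  obtain ⟨hab, hc, rfl, rfl, h⟩ := h
  refine ⟨neg_lt_neg hab, ?_, by simp, by simp, fun ξ hξ => ?_⟩
  · have hc' : ContinuousOn (fun ξ => U (-ξ)) (Icc (-b) (-a)) :=
      hc.comp continuousOn_neg fun x hx => ⟨by linarith [hx.2], by linarith [hx.1]⟩
    exact hc'.fst.prodMk hc'.snd.neg
  · obtain ⟨h1, h2, d, hd1, hd2⟩ := h (-ξ) ⟨by linarith [hξ.2], by linarith [hξ.1]⟩
    refine ⟨h1, ?_, -d, ?_, ?_⟩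
    · rw [charSpeed_mirror hk, h2, neg_neg]
    · exact (hd1.comp ξ (hasDerivAt_neg ξ)).congr_deriv (by ring)
    · exact (hd2.comp ξ (hasDerivAt_neg ξ)).neg.congr_deriv (by ring)

lemma IsRarefaction.congr {γ ρs ε a b : ℝ} {k : Family} {U V : ℝ → ℝ × ℝ} {L R : ℝ × ℝ}
    (hγ : 0 < γ) (hε : 0 < ε) (h : IsRarefaction γ ρs ε k U a b L R) (hUV : EqOn V U (Icc a b)) :
    IsRarefaction γ ρs ε k V a b L R := by
  rw [isRarefaction_iff hγ hε] at h ⊢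
  obtain ⟨hab, hc, hL, hR, h⟩ := h
  refine ⟨hab, hc.congr hUV, (hUV (left_mem_Icc.2 hab.le)).trans hL,
    (hUV (right_mem_Icc.2 hab.le)).trans hR, fun ξ hξ => ?_⟩
  rw [hUV (Ioo_subset_Icc_self hξ)]
  obtain ⟨h1, h2, d, hd1, hd2⟩ := h ξ hξ
  have he : V =ᶠ[𝓝 ξ] U := by
    filter_upwards [Ioo_mem_nhds hξ.1 hξ.2] with x hx using hUV (Ioo_subset_Icc_self hx)
  exact ⟨h1, h2, d, hd1.congr_of_eventuallyEq (he.fun_comp Prod.fst),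
    hd2.congr_of_eventuallyEq (he.fun_comp Prod.snd)⟩

/-- Along a rarefaction of the first family, the Riemann invariant is constant. -/
lemma IsRarefaction.exists_first_invariant {γ ρs ε a b : ℝ} {U : ℝ → ℝ × ℝ} {L R : ℝ × ℝ}
    (hγ : 0 < γ) (hε : 0 < ε) (h : IsRarefaction γ ρs ε .first U a b L R) :
    ∃ C, ∀ ξ ∈ Ioo a b, (U ξ).2 / (U ξ).1 = C - √ε * soundPotential γ ρs (U ξ).1 ∧
      ξ = C - √ε * speedPotential γ ρs (U ξ).1 := by
  obtain ⟨hab, -, -, -, h⟩ := (isRarefaction_iff hγ hε).1 h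
  let F : ℝ → ℝ := fun ξ => (U ξ).2 / (U ξ).1 + √ε * soundPotential γ ρs (U ξ).1
  have hF : ∀ ξ ∈ Ioo a b, HasDerivAt F 0 ξ := fun ξ hξ => by
    obtain ⟨hρ, hs, d, hd1, hd2⟩ := h ξ hξ
    refine ((hd2.div hd1 hρ.1.ne').add
      (((hasDerivAt_soundPotential hγ hρ).comp ξ hd1).const_mul √ε)).congr_deriv ?_
    rw [charSpeed_eq _ hγ hε hρ] at hs
    simp only [Family.sgn] at hs
    have hρ0 := hρ.1
    have e : √ε * (impedance γ ρs (U ξ).1 / (U ξ).1 ^ 2 * d) =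
        ((U ξ).2 / (U ξ).1 - ξ) * d / (U ξ).1 := by
      rw [show (U ξ).2 / (U ξ).1 - ξ = √ε * (impedance γ ρs (U ξ).1 / (U ξ).1) by linarith]
      field_simp
    rw [e]
    field_simp
    ring
  obtain ⟨c, hc⟩ := nonempty_Ioo.2 hab
  refine ⟨F c, fun ξ hξ => ?_⟩
  have e : F ξ = F c := isOpen_Ioo.is_const_of_deriv_eq_zero isPreconnected_Ioo
    (fun x hx => (hF x hx).differentiableAt.differentiableWithinAt)
    (fun x hx => (hF x hx).deriv) hξ hc
  obtain ⟨hρ, hs, -⟩ := h ξ hξ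
  rw [charSpeed_eq _ hγ hε hρ] at hs
  simp only [Family.sgn] at hs
  rw [← e]
  refine ⟨by simp only [F]; ring, ?_⟩
  nth_rewrite 1 [← hs]
  simp only [F, speedPotential]
  ring

/-- The relations inside the sector pass to its edges by continuity, wherever the density is
positive there. The density decreases in `ξ` because `ξ = C - √ε (P + √p')`. -/
lemma IsRarefaction.first_structure {γ ρs ε a b : ℝ} {U : ℝ → ℝ × ℝ} {L R : ℝ × ℝ}
    (hγ : 0 < γ) (hρs : 0 < ρs) (hε : 0 < ε) (h : IsRarefaction γ ρs ε .first U a b L R) :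
    (∃ C, ∀ ξ ∈ Icc a b, 0 < (U ξ).1 →
      (U ξ).2 / (U ξ).1 = C - √ε * soundPotential γ ρs (U ξ).1 ∧
      ξ = C - √ε * speedPotential γ ρs (U ξ).1) ∧
    (∀ ξ ∈ Ioo a b, 0 < (U ξ).1 ∧ (U ξ).1 ≤ L.1) ∧
    0 < L.1 ∧ L.1 < ρs ∧ 0 ≤ R.1 ∧ R.1 < L.1 := by
  obtain ⟨C, hC⟩ := h.exists_first_invariant hγ hε
  obtain ⟨hab, hc, rfl, rfl, hU⟩ := (isRarefaction_iff hγ hε).1 h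
  have hs := Real.sqrt_pos.2 hε
  have hne : ∀ e ∈ Icc a b, (𝓝[Ioo a b] e).NeBot := fun e he => by
    rwa [← mem_closure_iff_nhdsWithin_neBot, closure_Ioo hab.ne]
  have ht : ∀ e ∈ Icc a b, Tendsto U (𝓝[Ioo a b] e) (𝓝 (U e)) := fun e he =>
    (hc e he).mono_left (nhdsWithin_mono _ Ioo_subset_Icc_self)
  have ht1 := fun e he => (ht e he).fst_nhds
  have ht2 := fun e he => (ht e he).snd_nhds
  have hid : ∀ e : ℝ, Tendsto (fun ξ => ξ) (𝓝[Ioo a b] e) (𝓝 e) := fun e =>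
    tendsto_id.mono_left nhdsWithin_le_nhds
  have hmem : ∀ e ∈ Icc a b, 0 ≤ (U e).1 ∧ (U e).1 < ρs := fun e he => by
    have := hne e he
    have h0 : 0 ≤ (U e).1 := ge_of_tendsto (ht1 e he)
      (eventually_mem_nhdsWithin.mono fun ξ hξ => (hU ξ hξ).1.1.le)
    have h1 : (U e).1 ≤ ρs := le_of_tendsto (ht1 e he)
      (eventually_mem_nhdsWithin.mono fun ξ hξ => (hU ξ hξ).1.2.le)
    -- Reaching `ρs` would send the speed potential to infinity, whereas it equals `(C - ξ)/√ε` on a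
    -- bounded sector.
    refine ⟨h0, h1.lt_of_ne fun heq => ?_⟩
    have hl : Tendsto (fun ξ => (U ξ).1) (𝓝[Ioo a b] e) (𝓝[<] ρs) :=
      tendsto_nhdsWithin_iff.2 ⟨heq ▸ ht1 e he,
        eventually_mem_nhdsWithin.mono fun ξ hξ => (hU ξ hξ).1.2⟩
    have hG := ((tendsto_speedPotential_atTop hγ hρs).comp hl).const_mul_atTop hs
    have hG' : Tendsto (fun ξ => C - ξ) (𝓝[Ioo a b] e) atTop := hG.congr' <|
      eventually_mem_nhdsWithin.mono fun ξ hξ => by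
        have := (hC ξ hξ).2
        simp only [Function.comp_apply]
        linarith
    exact not_tendsto_nhds_of_tendsto_atTop hG' _ (tendsto_const_nhds.sub (hid e))
  have hanti : ∀ x ∈ Ioo a b, ∀ y ∈ Ioo a b, x < y → (U y).1 < (U x).1 := fun x hx y hy hxy => by
    have e1 := (hC x hx).2
    have e2 := (hC y hy).2
    exact ((strictMonoOn_speedPotential hγ).lt_iff_lt (hU y hy).1 (hU x hx).1).1
      (lt_of_mul_lt_mul_left (by linarith) hs.le)
  have hleft : ∀ x ∈ Ioo a b, (U x).1 ≤ (U a).1 := fun x hx => by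
    have ha := left_mem_Icc.2 hab.le
    have := hne a ha
    refine ge_of_tendsto (ht1 a ha) ?_
    filter_upwards [eventually_mem_nhdsWithin, nhdsWithin_le_nhds (Iio_mem_nhds hx.1)] with y hy hyx
    exact (hanti y hy x hx hyx).le
  have hright : ∀ x ∈ Ioo a b, (U b).1 ≤ (U x).1 := fun x hx => by
    have hb := right_mem_Icc.2 hab.le
    have := hne b hb
    refine le_of_tendsto (ht1 b hb) ?_
    filter_upwards [eventually_mem_nhdsWithin, nhdsWithin_le_nhds (Ioi_mem_nhds hx.2)] with y hy hyx
    exact (hanti x hx y hy hyx).le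
  obtain ⟨x, hax, hxb⟩ := exists_between hab
  obtain ⟨y, hxy, hyb⟩ := exists_between hxb
  have hx : x ∈ Ioo a b := ⟨hax, hxb⟩
  have hy : y ∈ Ioo a b := ⟨hax.trans hxy, hyb⟩
  refine ⟨⟨C, fun ξ hξ h0 => ?_⟩, fun ξ hξ => ⟨(hU ξ hξ).1.1, hleft ξ hξ⟩,
    (hU x hx).1.1.trans_le (hleft x hx), (hmem a (left_mem_Icc.2 hab.le)).2,
    (hmem b (right_mem_Icc.2 hab.le)).1,
    ((hright y hy).trans_lt (hanti x hx y hy hxy)).trans_le (hleft x hx)⟩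
  have := hne ξ hξ
  have hI : Ioo 0 ρs ∈ 𝓝 (U ξ).1 := Ioo_mem_nhds h0 (hmem ξ hξ).2
  have hP := ((continuousOn_soundPotential hγ).continuousAt hI).tendsto.comp (ht1 ξ hξ)
  have hG := ((continuousOn_speedPotential hγ).continuousAt hI).tendsto.comp (ht1 ξ hξ)
  constructor
  · refine tendsto_nhds_unique_of_eventuallyEq ((ht2 ξ hξ).div (ht1 ξ hξ) h0.ne')
      (tendsto_const_nhds.sub (hP.const_mul √ε)) ?_
    exact eventually_mem_nhdsWithin.mono fun ξ hξ => (hC ξ hξ).1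
  · refine tendsto_nhds_unique_of_eventuallyEq (hid ξ)
      (tendsto_const_nhds.sub (hG.const_mul √ε)) ?_
    exact eventually_mem_nhdsWithin.mono fun ξ hξ => (hC ξ hξ).2

/-- When the wave ends in the vacuum, `R.2 / R.1` carries no information. What remains is a bound on
the edge `b` through the speeds of all densities crossed, which is enough to compare it with the
2-wave. -/
lemma IsRarefaction.first_spec {γ ρs ε a b : ℝ} {U : ℝ → ℝ × ℝ} {L R : ℝ × ℝ}
    (hγ : 0 < γ) (hρs : 0 < ρs) (hε : 0 < ε) (h : IsRarefaction γ ρs ε .first U a b L R) :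
    0 < L.1 ∧ L.1 < ρs ∧ 0 ≤ R.1 ∧ R.1 < L.1 ∧ charSpeed γ ρs ε .first L = a ∧
    (0 < R.1 → R.2 / R.1 = L.2 / L.1 - velocityJump γ ρs ε .rarefaction L.1 R.1 ∧
      charSpeed γ ρs ε .first R = b) ∧
    (R.1 = 0 →
      (∀ ρ ∈ Ioo 0 L.1, L.2 / L.1 - √ε * (speedPotential γ ρs ρ - soundPotential γ ρs L.1) < b) ∧
      (BddBelow (soundPotential γ ρs '' Ioo 0 ρs) → R = (0, 0))) := by
  obtain ⟨⟨C, hC⟩, hint, hL0, hLs, hR0, hRL⟩ := h.first_structure hγ hρs hε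
  obtain ⟨hab, hc, rfl, rfl, h⟩ := h
  have ha := left_mem_Icc.2 hab.le
  have hb := right_mem_Icc.2 hab.le
  obtain ⟨a1, a2⟩ := hC a ha hL0
  have hcs : ∀ e, (U e).1 ∈ Ioo 0 ρs → (U e).2 / (U e).1 = C - √ε * soundPotential γ ρs (U e).1 →
      e = C - √ε * speedPotential γ ρs (U e).1 → charSpeed γ ρs ε .first (U e) = e := by
    intro e h1 h2 h3
    rw [charSpeed_eq _ hγ hε h1, h2]
    refine Eq.trans ?_ h3.symm
    simp only [Family.sgn, speedPotential]
    ring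
  refine ⟨hL0, hLs, hR0, hRL, hcs a ⟨hL0, hLs⟩ a1 a2, fun hb0 => ?_, fun hb0 => ⟨?_, ?_⟩⟩
  · obtain ⟨b1, b2⟩ := hC b hb hb0
    refine ⟨?_, hcs b ⟨hb0, hRL.trans hLs⟩ b1 b2⟩
    rw [b1, a1]
    simp only [velocityJump]
    ring
  · intro ρ hρ
    obtain ⟨ξ, hξ, rfl⟩ := intermediate_value_Icc' hab.le hc.fst ⟨hb0 ▸ hρ.1.le, hρ.2.le⟩
    have hξb : ξ < b := hξ.2.lt_of_ne fun e => hρ.1.ne' (e ▸ hb0)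
    have := (hC ξ hξ hρ.1).2
    rw [a1]
    linarith
  · rintro ⟨P₀, hP₀⟩
    refine Prod.ext hb0 ?_
    have hne : (𝓝[Ioo a b] b).NeBot := by
      rwa [← mem_closure_iff_nhdsWithin_neBot, closure_Ioo hab.ne]
    have ht : Tendsto U (𝓝[Ioo a b] b) (𝓝 (U b)) :=
      (hc b hb).mono_left (nhdsWithin_mono _ Ioo_subset_Icc_self)
    -- `M` bounds the velocity, since `P` lies between its lower bound and its value at `L`; hence
    -- `q = ρu` vanishes with `ρ`.
    obtain ⟨M, hM1, hM2⟩ : ∃ M, C - √ε * P₀ ≤ M ∧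
        -(C - √ε * soundPotential γ ρs (U a).1) ≤ M := ⟨_, le_max_left _ _, le_max_right _ _⟩
    have hz : Tendsto (fun ξ => (U ξ).2) (𝓝[Ioo a b] b) (𝓝 0) := by
      refine squeeze_zero_norm' (a := fun ξ => (U ξ).1 * M) ?_ ?_
      · filter_upwards [eventually_mem_nhdsWithin] with ξ hξ
        obtain ⟨h1, h2⟩ := hint ξ hξ
        have e := (hC ξ (Ioo_subset_Icc_self hξ) h1).1
        have hI : (U ξ).1 ∈ Ioo 0 ρs := ⟨h1, h2.trans_lt hLs⟩
        have m1 := mul_le_mul_of_nonneg_left (hP₀ (mem_image_of_mem _ hI)) (Real.sqrt_nonneg ε)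
        have m2 := mul_le_mul_of_nonneg_left
          ((strictMonoOn_soundPotential hγ).monotoneOn hI ⟨hL0, hLs⟩ h2) (Real.sqrt_nonneg ε)
        rw [show (U ξ).2 = (U ξ).1 * ((U ξ).2 / (U ξ).1) by field_simp, e, Real.norm_eq_abs,
          abs_mul, abs_of_pos h1]
        exact mul_le_mul_of_nonneg_left (abs_le.2 ⟨by linarith, by linarith⟩) h1.le
      · have := ht.fst_nhds.mul_const M
        rwa [hb0, zero_mul] at this
    exact tendsto_nhds_unique ht.snd_nhds hz

/-! ### Construction of rarefactions. -/

/-- The inverse of a continuous strictly increasing function on a compact interval. -/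
lemma exists_continuousOn_inverse {H : ℝ → ℝ} {a b : ℝ} (hab : a ≤ b)
    (hc : ContinuousOn H (Icc a b)) (hm : StrictMonoOn H (Icc a b)) :
    ∃ g : ℝ → ℝ, ContinuousOn g (Icc (H a) (H b)) ∧ (∀ x ∈ Icc a b, g (H x) = x) ∧
      ∀ y ∈ Icc (H a) (H b), g y ∈ Icc a b ∧ H (g y) = y := by
  have hsurj : SurjOn H (Icc a b) (Icc (H a) (H b)) := intermediate_value_Icc hab hc
  let g := Function.invFunOn H (Icc a b)
  have hg : ∀ y ∈ Icc (H a) (H b), g y ∈ Icc a b ∧ H (g y) = y := fun y hy =>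
    ⟨hsurj.mapsTo_invFunOn hy, hsurj.rightInvOn_invFunOn hy⟩
  refine ⟨g, fun y hy => ?_, fun x hx => hm.injOn.leftInvOn_invFunOn hx, hg⟩
  obtain ⟨h1, h2⟩ := hg y hy
  refine tendsto_order.2 ⟨fun c hcy => ?_, fun c hcy => ?_⟩
  · by_cases hca : c < a
    · filter_upwards [eventually_mem_nhdsWithin] with z hz using hca.trans_le (hg z hz).1.1
    · have hcI : c ∈ Icc a b := ⟨not_lt.1 hca, hcy.le.trans h1.2⟩
      have : H c < y := h2 ▸ hm hcI h1 hcy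
      filter_upwards [eventually_mem_nhdsWithin, nhdsWithin_le_nhds (Ioi_mem_nhds this)]
        with z hz hcz
      obtain ⟨z1, z2⟩ := hg z hz
      exact (hm.lt_iff_lt hcI z1).1 (z2.symm ▸ hcz)
  · by_cases hcb : b < c
    · filter_upwards [eventually_mem_nhdsWithin] with z hz using (hg z hz).1.2.trans_lt hcb
    · have hcI : c ∈ Icc a b := ⟨h1.1.trans hcy.le, not_lt.1 hcb⟩
      have : y < H c := h2 ▸ hm h1 hcI hcy
      filter_upwards [eventually_mem_nhdsWithin, nhdsWithin_le_nhds (Iio_mem_nhds this)]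
        with z hz hcz
      obtain ⟨z1, z2⟩ := hg z hz
      exact (hm.lt_iff_lt z1 hcI).1 (z2.symm ▸ hcz)

/-- A rarefaction of the first family is obtained by inverting the speed potential. -/
lemma exists_isRarefaction_first_of_extension {γ ρs ε α β C : ℝ} {H : ℝ → ℝ} (hγ : 0 < γ)
    (hε : 0 < ε) (hα : 0 ≤ α) (hαβ : α < β) (hβ : β < ρs) (hc : ContinuousOn H (Icc α β))
    (hm : StrictMonoOn H (Icc α β)) (hH : EqOn H (speedPotential γ ρs) (Ioc α β))
    (hP : ContinuousOn (fun ρ => ρ * soundPotential γ ρs ρ) (Icc α β)) :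
    ∃ U, IsRarefaction γ ρs ε .first U (C - √ε * H β) (C - √ε * H α)
      (β, β * (C - √ε * soundPotential γ ρs β)) (α, α * (C - √ε * soundPotential γ ρs α)) := by
  obtain ⟨g, hgc, hgH, hg⟩ := exists_continuousOn_inverse hαβ.le hc hm
  have hs := Real.sqrt_pos.2 hε
  have hα' := left_mem_Icc.2 hαβ.le
  have hβ' := right_mem_Icc.2 hαβ.le
  have hy : ∀ y, (C - (C - √ε * y)) / √ε = y := fun y => by
    rw [sub_sub_cancel, mul_div_cancel_left₀ _ hs.ne']
  let F : ℝ → ℝ × ℝ := fun ρ => (ρ, ρ * (C - √ε * soundPotential γ ρs ρ))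
  have hF : ContinuousOn F (Icc α β) := by
    refine continuousOn_id.prodMk ?_
    have : ContinuousOn (fun ρ => ρ * C - √ε * (ρ * soundPotential γ ρs ρ)) (Icc α β) :=
      (continuousOn_id.mul continuousOn_const).sub (continuousOn_const.mul hP)
    exact this.congr fun ρ _ => by ring
  have hlin : Continuous fun ξ => (C - ξ) / √ε := by fun_prop
  refine ⟨fun ξ => F (g ((C - ξ) / √ε)), (isRarefaction_iff hγ hε).2 ⟨?_, ?_, ?_, ?_, ?_⟩⟩
  · have := hm hα' hβ' hαβ
    have := mul_lt_mul_of_pos_left this hs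
    linarith
  · refine hF.comp (hgc.comp hlin.continuousOn fun ξ hξ => ?_) fun ξ hξ => (hg _ ?_).1 <;>
    · rw [mem_Icc, le_div_iff₀ hs, div_le_iff₀ hs]
      exact ⟨by linarith [hξ.2], by linarith [hξ.1]⟩
  · simp only [hy, hgH β hβ', F]
  · simp only [hy, hgH α hα', F]
  · intro ξ hξ
    have hyI : (C - ξ) / √ε ∈ Ioo (H α) (H β) := by
      rw [mem_Ioo, lt_div_iff₀ hs, div_lt_iff₀ hs]
      exact ⟨by linarith [hξ.2], by linarith [hξ.1]⟩
    have hyn : ∀ᶠ y in 𝓝 ((C - ξ) / √ε), g y ∈ Ioo 0 ρs ∧ speedPotential γ ρs (g y) = y := by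
      filter_upwards [Ioo_mem_nhds hyI.1 hyI.2] with y hy
      obtain ⟨h1, h2⟩ := hg y (Ioo_subset_Icc_self hy)
      have h3 : α < g y := (hm.lt_iff_lt hα' h1).1 (h2.symm ▸ hy.1)
      exact ⟨⟨hα.trans_lt h3, h1.2.trans_lt hβ⟩, (hH ⟨h3, h1.2⟩).symm.trans h2⟩
    obtain ⟨hρ, hG⟩ := hyn.self_of_nhds
    -- The profile is differentiable by the inverse function rule, the speed potential having a
    -- nonzero derivative.
    obtain ⟨d, hd, hGd⟩ := exists_hasDerivAt_speedPotential hγ hρ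
    have hgd := HasDerivAt.of_local_left_inverse (hgc.continuousAt (Icc_mem_nhds hyI.1 hyI.2))
      hGd hd.ne' (hyn.mono fun _ h => h.2)
    have hlind : HasDerivAt (fun ξ => (C - ξ) / √ε) (-1 / √ε) ξ :=
      ((hasDerivAt_id ξ).const_sub C).div_const _
    have h1 := hgd.comp ξ hlind
    have h2 := h1.mul ((((hasDerivAt_soundPotential hγ hρ).comp ξ h1).const_mul √ε).const_sub C)
    have hξ' : ξ = C - √ε * speedPotential γ ρs (g ((C - ξ) / √ε)) := by
      rw [hG, mul_div_cancel₀ _ hs.ne']; ring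
    refine ⟨hρ, ?_, _, h1, h2.congr_deriv ?_⟩
    · rw [charSpeed_eq _ hγ hε hρ]
      refine Eq.trans ?_ hξ'.symm
      simp only [F, Family.sgn, speedPotential, mul_div_cancel_left₀ _ hρ.1.ne']
      ring
    · have hρ0 := hρ.1
      refine Eq.trans ?_ (congrArg (· * (d⁻¹ * (-1 / √ε))) hξ').symm
      simp only [Function.comp_apply, speedPotential]
      generalize g ((C - ξ) / √ε) = ρ at hρ0
      field_simp
      ring

lemma exists_isRarefaction_first {γ ρs ε : ℝ} {L R : ℝ × ℝ} (hγ : 0 < γ) (hε : 0 < ε)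
    (hR : 0 < R.1) (hlt : R.1 < L.1) (hL : L.1 < ρs)
    (h : R.2 / R.1 = L.2 / L.1 - velocityJump γ ρs ε .rarefaction L.1 R.1) :
    ∃ U a b, IsRarefaction γ ρs ε .first U a b L R := by
  have hsub : Icc R.1 L.1 ⊆ Ioo 0 ρs := fun x hx => ⟨hR.trans_le hx.1, hx.2.trans_lt hL⟩
  obtain ⟨U, hU⟩ := exists_isRarefaction_first_of_extension
    (C := L.2 / L.1 + √ε * soundPotential γ ρs L.1) hγ hε hR.le hlt hL
    ((continuousOn_speedPotential hγ).mono hsub) ((strictMonoOn_speedPotential hγ).mono hsub)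
    (fun _ _ => rfl) (continuousOn_id.mul ((continuousOn_soundPotential hγ).mono hsub))
  have e1 : L.1 * (L.2 / L.1 + √ε * soundPotential γ ρs L.1 - √ε * soundPotential γ ρs L.1) =
      L.2 := by rw [add_sub_cancel_right, mul_div_cancel₀ _ (hR.trans hlt).ne']
  have e2 : R.1 * (L.2 / L.1 + √ε * soundPotential γ ρs L.1 - √ε * soundPotential γ ρs R.1) =
      R.2 := by
    rw [← mul_div_cancel₀ R.2 hR.ne', h]
    simp only [velocityJump]
    ring
  rw [e1, e2] at hU
  exact ⟨U, _, _, hU⟩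

/-- If `P` is bounded below, both potentials tend to `inf P` at the vacuum, so the speed potential
extends continuously to density zero and can be inverted up to there. -/
lemma exists_isRarefaction_first_vacuum {γ ρs ε : ℝ} {L : ℝ × ℝ} (hγ : 0 < γ) (hε : 0 < ε)
    (hL : L.1 ∈ Ioo 0 ρs) (hP : BddBelow (soundPotential γ ρs '' Ioo 0 ρs)) :
    ∃ U a, IsRarefaction γ ρs ε .first U a
      (L.2 / L.1 + √ε * (soundPotential γ ρs L.1 - sInf (soundPotential γ ρs '' Ioo 0 ρs)))
      L (0, 0) := by
  set P₀ := sInf (soundPotential γ ρs '' Ioo 0 ρs) with hP₀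
  have hle : ∀ x ∈ Ioo 0 ρs, P₀ ≤ soundPotential γ ρs x := fun x hx =>
    csInf_le hP (mem_image_of_mem _ hx)
  have hsub : Ioc 0 L.1 ⊆ Ioo 0 ρs := fun x hx => ⟨hx.1, hx.2.trans_lt hL.2⟩
  have hGt : Tendsto (speedPotential γ ρs) (𝓝[Ioc 0 L.1] 0) (𝓝 P₀) := by
    refine tendsto_order.2 ⟨fun c hc => ?_, fun c hc => ?_⟩
    · filter_upwards [eventually_mem_nhdsWithin] with x hx using
        (hc.trans_le (hle x (hsub hx))).trans (soundPotential_lt_speedPotential hγ (hsub hx))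
    · obtain ⟨_, ⟨m, hm, rfl⟩, hmc⟩ := exists_lt_of_csInf_lt ⟨_, mem_image_of_mem _ hL⟩ hc
      obtain ⟨ρ, hρ, hρm⟩ := exists_speedPotential_lt_soundPotential hγ hm
      filter_upwards [eventually_mem_nhdsWithin, nhdsWithin_le_nhds (Iio_mem_nhds hρ.1)]
        with x hx hxρ
      exact ((strictMonoOn_speedPotential hγ (hsub hx) ⟨hρ.1, hρ.2.trans hm.2⟩ hxρ).trans
        hρm).trans hmc
  have hPt : Tendsto (soundPotential γ ρs) (𝓝[Ioc 0 L.1] 0) (𝓝 P₀) :=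
    tendsto_of_tendsto_of_tendsto_of_le_of_le' tendsto_const_nhds hGt
      (eventually_mem_nhdsWithin.mono fun x hx => hle x (hsub hx))
      (eventually_mem_nhdsWithin.mono fun x hx =>
        (soundPotential_lt_speedPotential hγ (hsub hx)).le)
  have hIcc : Icc 0 L.1 = insert 0 (Ioc 0 L.1) := (Ioc_insert_left hL.1.le).symm
  have hcont : ∀ f f' : ℝ → ℝ, ContinuousOn f' (Ioo 0 ρs) → EqOn f f' (Ioc 0 L.1) →
      Tendsto f' (𝓝[Ioc 0 L.1] 0) (𝓝 (f 0)) → ContinuousOn f (Icc 0 L.1) := by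
    intro f f' hf' hff' hf0 x hx
    rcases hx.1.eq_or_lt with rfl | hx0
    · rw [hIcc, continuousWithinAt_insert_self]
      exact hf0.congr' (eventually_mem_nhdsWithin.mono fun y hy => (hff' hy).symm)
    · have he : f =ᶠ[𝓝[Icc 0 L.1] x] f' := by
        filter_upwards [eventually_mem_nhdsWithin, nhdsWithin_le_nhds (Ioi_mem_nhds hx0)]
          with y hy hy0 using hff' ⟨hy0, hy.2⟩
      exact (hf'.continuousAt (Ioo_mem_nhds hx0 (hx.2.trans_lt hL.2))).continuousWithinAt
        |>.congr_of_eventuallyEq he (hff' ⟨hx0, hx.2⟩)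
  -- The formula for `speedPotential` divides by zero at the vacuum; the update puts the limit there
  -- instead.
  have hG : EqOn (Function.update (speedPotential γ ρs) 0 P₀) (speedPotential γ ρs)
      (Ioc 0 L.1) := fun x hx => Function.update_of_ne hx.1.ne' _ _
  obtain ⟨U, hU⟩ := exists_isRarefaction_first_of_extension (ε := ε)
    (C := L.2 / L.1 + √ε * soundPotential γ ρs L.1)
    (H := Function.update (speedPotential γ ρs) 0 P₀) hγ hε le_rfl hL.1 hL.2
    (hcont _ _ (continuousOn_speedPotential hγ) hG (by simpa using hGt))
    (by
      intro x hx y hy hxy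
      have hy' : y ∈ Ioc 0 L.1 := ⟨hx.1.trans_lt hxy, hy.2⟩
      rw [hG hy']
      rcases hx.1.eq_or_lt with rfl | hx0
      · rw [Function.update_self]
        exact (hle y (hsub hy')).trans_lt (soundPotential_lt_speedPotential hγ (hsub hy'))
      · have hx' : x ∈ Ioc 0 L.1 := ⟨hx0, hx.2⟩
        rw [hG hx']
        exact strictMonoOn_speedPotential hγ (hsub hx') (hsub hy') hxy) hG
    (hcont _ (fun ρ => ρ * soundPotential γ ρs ρ)
      (continuousOn_id.mul (continuousOn_soundPotential hγ)) (fun _ _ => rfl) (by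
        have := (tendsto_id.mono_left (nhdsWithin_le_nhds (a := (0 : ℝ)) (s := Ioc 0 L.1))).mul hPt
        simpa using this))
  have e1 : L.1 * (L.2 / L.1 + √ε * soundPotential γ ρs L.1 - √ε * soundPotential γ ρs L.1) =
      L.2 := by rw [add_sub_cancel_right, mul_div_cancel₀ _ hL.1.ne']
  have e2 : L.2 / L.1 + √ε * soundPotential γ ρs L.1 - √ε * P₀ =
      L.2 / L.1 + √ε * (soundPotential γ ρs L.1 - P₀) := by ring
  rw [e1, Function.update_self, e2, zero_mul] at hU
  exact ⟨U, _, hU⟩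

/-! ### Waves of either nature, and their order in a solution. -/

lemma IsWave.mirror {γ ρs ε a b : ℝ} {k k' : Family} {w : WaveKind} {U : ℝ → ℝ × ℝ}
    {L R : ℝ × ℝ} (hγ : 0 < γ) (hε : 0 < ε) (hk : k'.sgn = -k.sgn)
    (h : IsWave γ ρs ε k w U a b L R) :
    IsWave γ ρs ε k' w (fun ξ => mirror (U (-ξ))) (-b) (-a) (mirror R) (mirror L) := by
  cases w
  · obtain ⟨rfl, h⟩ := h
    exact ⟨rfl, h.mirror hk⟩
  · exact IsRarefaction.mirror hγ hε hk h

lemma IsWave.congr {γ ρs ε a b : ℝ} {k : Family} {w : WaveKind} {U V : ℝ → ℝ × ℝ}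
    {L R : ℝ × ℝ} (hγ : 0 < γ) (hε : 0 < ε) (h : IsWave γ ρs ε k w U a b L R)
    (hUV : EqOn V U (Icc a b)) : IsWave γ ρs ε k w V a b L R := by
  cases w
  · exact h
  · exact IsRarefaction.congr hγ hε h hUV

lemma IsWave.le {γ ρs ε a b : ℝ} {k : Family} {w : WaveKind} {U : ℝ → ℝ × ℝ}
    {L R : ℝ × ℝ} (h : IsWave γ ρs ε k w U a b L R) : a ≤ b := by
  cases w
  · exact h.1.le
  · obtain ⟨h, -⟩ := h
    exact h.le

/-- A wave of nature `w` can join, within its family, the density `ρ` to the density `a` on its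
outer side: densities increase inwards through shocks and decrease through rarefactions. -/
def IsAdmissibleJump (w : WaveKind) (a ρ : ℝ) : Prop :=
  (w = .shock ∧ a < ρ) ∨ (w = .rarefaction ∧ ρ < a)

lemma charSpeed_first_lt {γ ρs ε : ℝ} {v : ℝ × ℝ} (hγ : 0 < γ) (hε : 0 < ε)
    (hv : v.1 ∈ Ioo 0 ρs) : charSpeed γ ρs ε .first v < v.2 / v.1 := by
  rw [charSpeed_eq _ hγ hε hv]
  have := mul_pos (Real.sqrt_pos.2 hε) (div_pos (impedance_pos hγ hv) hv.1)
  simp only [Family.sgn]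
  linarith

/-- The comparisons of `a` and `b` with the velocities and characteristic speeds decide which wave
can follow which; the remaining clauses relate the two states. -/
lemma IsWave.first_spec {γ ρs ε a b : ℝ} {w : WaveKind} {U : ℝ → ℝ × ℝ} {L R : ℝ × ℝ}
    (hγ : 0 < γ) (hρs : 0 < ρs) (hε : 0 < ε) (h : IsWave γ ρs ε .first w U a b L R) :
    L.1 ∈ Ioo 0 ρs ∧ R.1 ∈ Ico 0 ρs ∧ a ≤ charSpeed γ ρs ε .first L ∧ a < L.2 / L.1 ∧
    (0 < R.1 → R.2 / R.1 = L.2 / L.1 - velocityJump γ ρs ε w L.1 R.1 ∧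
      charSpeed γ ρs ε .first R ≤ b ∧ b < R.2 / R.1 ∧ IsAdmissibleJump w L.1 R.1) ∧
    (R.1 = 0 → w = .rarefaction ∧
      (∀ ρ ∈ Ioo 0 L.1, L.2 / L.1 - √ε * (speedPotential γ ρs ρ - soundPotential γ ρs L.1) < b) ∧
      (BddBelow (soundPotential γ ρs '' Ioo 0 ρs) → R = (0, 0))) := by
  cases w
  · obtain ⟨rfl, h⟩ := h
    obtain ⟨h1, h2, h3⟩ := h.first_spec hγ hε
    obtain ⟨hL, hR, -, -, h5, h6⟩ := h
    exact ⟨hL, ⟨hR.1.le, hR.2⟩, h6.le, h6.trans (charSpeed_first_lt hγ hε hL),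
      fun _ => ⟨h2, h5.le, h3, Or.inl ⟨rfl, h1⟩⟩, fun h0 => absurd h0 hR.1.ne'⟩
  · obtain ⟨hL0, hLs, hR0, hRL, ha, h1, h2⟩ := IsRarefaction.first_spec hγ hρs hε h
    refine ⟨⟨hL0, hLs⟩, ⟨hR0, hRL.trans hLs⟩, ha.ge,
      ha ▸ charSpeed_first_lt hγ hε ⟨hL0, hLs⟩, fun h0 => ?_, fun h0 => ⟨rfl, h2 h0⟩⟩
    exact ⟨(h1 h0).1, (h1 h0).2.le,
      (h1 h0).2 ▸ charSpeed_first_lt hγ hε ⟨h0, hRL.trans hLs⟩, Or.inr ⟨rfl, hRL⟩⟩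

lemma IsWave.second_spec {γ ρs ε a b : ℝ} {w : WaveKind} {U : ℝ → ℝ × ℝ} {L R : ℝ × ℝ}
    (hγ : 0 < γ) (hρs : 0 < ρs) (hε : 0 < ε) (h : IsWave γ ρs ε .second w U a b L R) :
    R.1 ∈ Ioo 0 ρs ∧ L.1 ∈ Ico 0 ρs ∧ charSpeed γ ρs ε .second R ≤ b ∧ R.2 / R.1 < b ∧
    (0 < L.1 → L.2 / L.1 = R.2 / R.1 + velocityJump γ ρs ε w R.1 L.1 ∧
      a ≤ charSpeed γ ρs ε .second L ∧ L.2 / L.1 < a ∧ IsAdmissibleJump w R.1 L.1) ∧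
    (L.1 = 0 → w = .rarefaction ∧
      (∀ ρ ∈ Ioo 0 R.1, a < R.2 / R.1 + √ε * (speedPotential γ ρs ρ - soundPotential γ ρs R.1)) ∧
      (BddBelow (soundPotential γ ρs '' Ioo 0 ρs) → L = (0, 0))) := by
  have hk : Family.first.sgn = -Family.second.sgn := by simp [Family.sgn]
  obtain ⟨h1, h2, h3, h4, h5, h6⟩ := (h.mirror hγ hε hk).first_spec hγ hρs hε
  simp only [charSpeed_mirror hk, mirror_fst, mirror_snd, neg_div] at h1 h2 h3 h4 h5 h6
  refine ⟨h1, h2, by linarith, by linarith, fun h0 => ?_, fun h0 => ?_⟩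
  · obtain ⟨e1, e2, e3, e4⟩ := h5 h0
    exact ⟨by linarith, by linarith, by linarith, e4⟩
  · obtain ⟨e1, e2, e3⟩ := h6 h0
    refine ⟨e1, fun ρ hρ => by linarith [e2 ρ hρ], fun hb => ?_⟩
    have := congrArg _root_.mirror (e3 hb)
    simpa [_root_.mirror] using this

/-- Nothing can follow a wave of the second family. -/
lemma IsFan.eq_const {γ ρs ε c : ℝ} {U : ℝ → ℝ × ℝ} {r v : ℝ × ℝ}
    (hγ : 0 < γ) (hρs : 0 < ρs) (hε : 0 < ε) (h : IsFan γ ρs ε U r c v) (hv : 0 < v.1)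
    (h1 : v.2 / v.1 < c) (h2 : charSpeed γ ρs ε .second v ≤ c) :
    v = r ∧ ∀ ξ, c < ξ → U ξ = r := by
  cases h with
  | const _ h => exact ⟨rfl, h⟩
  | wave _ a b _ v' k w hca _ hw _ =>
    exfalso
    cases k
    · have := (hw.first_spec hγ hρs hε).2.2.2.1
      linarith
    · have := ((hw.second_spec hγ hρs hε).2.2.2.2.1 hv).2.1
      linarith

/-- Only a wave of the second family can follow a wave of the first family. -/
lemma IsFan.const_or_second {γ ρs ε c : ℝ} {U : ℝ → ℝ × ℝ} {r v : ℝ × ℝ}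
    (hγ : 0 < γ) (hρs : 0 < ρs) (hε : 0 < ε) (h : IsFan γ ρs ε U r c v)
    (h1 : 0 < v.1 → charSpeed γ ρs ε .first v ≤ c) :
    v = r ∨ ∃ a b w, c < a ∧ (∀ ξ ∈ Ioo c a, U ξ = v) ∧
      IsWave γ ρs ε .second w U a b v r ∧ ∀ ξ, b < ξ → U ξ = r := by
  cases h with
  | const _ h => exact Or.inl rfl
  | wave _ a b _ v' k w hca h hw hf =>
    right
    cases k
    · exfalso
      obtain ⟨h3, -, h4, -⟩ := hw.first_spec hγ hρs hε
      have := h1 h3.1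
      linarith
    · obtain ⟨h3, -, h4, h5, -⟩ := hw.second_spec hγ hρs hε
      obtain ⟨rfl, h6⟩ := hf.eq_const hγ hρs hε h3.1 h5 h4
      exact ⟨a, b, w, hca, h, hw, h6⟩

/-- A 1-wave can only be followed by a 2-wave, and a 2-wave by nothing. The three degenerate cases
are kept here and excluded later through uniqueness of the density. -/
lemma IsRiemannSolution.structure {γ ρs ε : ℝ} {U : ℝ → ℝ × ℝ} {l r : ℝ × ℝ}
    (hγ : 0 < γ) (hρs : 0 < ρs) (hε : 0 < ε) (h : IsRiemannSolution γ ρs ε l r U) :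
    l = r ∨ (∃ a b w, IsWave γ ρs ε .first w U a b l r) ∨
      (∃ a b w, IsWave γ ρs ε .second w U a b l r) ∨
      ∃ w₁ w₂ m, HasForm γ ρs ε l r w₁ w₂ m U := by
  obtain ⟨c, hc, h⟩ := h
  cases h with
  | const _ h => exact Or.inl rfl
  | wave _ a b _ v' k w hca h hw hf =>
    right
    cases k
    · obtain ⟨-, -, -, -, h5, -⟩ := hw.first_spec hγ hρs hε
      rcases hf.const_or_second hγ hρs hε (fun h0 => (h5 h0).2.1) with
        rfl | ⟨a₂, b₂, w₂, h1, h2, h3, h4⟩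
      · exact Or.inl ⟨a, b, w, hw⟩
      · refine Or.inr (Or.inr ⟨w, w₂, v', a, b, a₂, b₂, hw.le, h1, h3.le, fun ξ hξ => ?_, hw, h2,
          h3, h4⟩)
        rcases le_or_gt ξ c with hξc | hξc
        · exact hc ξ hξc
        · exact h ξ ⟨hξc, hξ⟩
    · obtain ⟨h3, -, h4, h5, -⟩ := hw.second_spec hγ hρs hε
      obtain ⟨rfl, -⟩ := hf.eq_const hγ hρs hε h3.1 h5 h4
      exact Or.inr (Or.inl ⟨a, b, w, hw⟩)

/-! ### The scalar equation for the intermediate density. -/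

/-- The velocity jump along the composite curve of admissible waves issued from density `a`. -/
noncomputable def compositeJump (γ ρs ε a ρ : ℝ) : ℝ :=
  if ρ ≤ a then velocityJump γ ρs ε .rarefaction a ρ else velocityJump γ ρs ε .shock a ρ

lemma compositeJump_self (γ ρs ε a : ℝ) : compositeJump γ ρs ε a a = 0 := by
  simp [compositeJump, velocityJump_self]

lemma IsAdmissibleJump.compositeJump_eq {γ ρs ε a ρ : ℝ} {w : WaveKind}
    (h : IsAdmissibleJump w a ρ) : compositeJump γ ρs ε a ρ = velocityJump γ ρs ε w a ρ := by
  rcases h with ⟨rfl, h⟩ | ⟨rfl, h⟩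
  · rw [compositeJump, if_neg h.not_ge]
  · rw [compositeJump, if_pos h.le]

lemma IsAdmissibleJump.unique {w w' : WaveKind} {a ρ : ℝ} (h : IsAdmissibleJump w a ρ)
    (h' : IsAdmissibleJump w' a ρ) : w = w' := by
  rcases h with ⟨rfl, h⟩ | ⟨rfl, h⟩ <;> rcases h' with ⟨rfl, h'⟩ | ⟨rfl, h'⟩
  · rfl
  · exact absurd h h'.not_gt
  · exact absurd h h'.not_gt
  · rfl

lemma IsAdmissibleJump.ne {w : WaveKind} {a ρ : ℝ} (h : IsAdmissibleJump w a ρ) : ρ ≠ a := by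
  rcases h with ⟨-, h⟩ | ⟨-, h⟩
  · exact h.ne'
  · exact h.ne

lemma strictMonoOn_compositeJump {γ ρs ε a : ℝ} (hγ : 0 < γ) (hε : 0 < ε)
    (ha : a ∈ Ioo 0 ρs) : StrictMonoOn (compositeJump γ ρs ε a) (Ioo 0 ρs) := by
  have h1 : StrictMonoOn (compositeJump γ ρs ε a) (Ioc 0 a) :=
    ((strictMonoOn_velocityJump .rarefaction hγ hε ha).mono fun x hx =>
      ⟨hx.1, hx.2.trans_lt ha.2⟩).congr fun x hx => by rw [compositeJump, if_pos hx.2]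
  have h2 : StrictMonoOn (compositeJump γ ρs ε a) (Ico a ρs) :=
    ((strictMonoOn_velocityJump .shock hγ hε ha).mono fun x hx =>
      ⟨ha.1.trans_le hx.1, hx.2⟩).congr fun x hx => by
        rcases hx.1.eq_or_lt with rfl | h
        · rw [compositeJump_self, velocityJump_self]
        · rw [compositeJump, if_neg h.not_ge]
  have h := h1.union h2 (isGreatest_Ioc ha.1) (isLeast_Ico ha.2)
  rwa [Ioc_union_Ico_eq_Ioo ha.1 ha.2] at h

lemma strictMonoOn_compositeJump_add {γ ρs ε a b : ℝ} (hγ : 0 < γ) (hε : 0 < ε)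
    (ha : a ∈ Ioo 0 ρs) (hb : b ∈ Ioo 0 ρs) :
    StrictMonoOn (fun ρ => compositeJump γ ρs ε a ρ + compositeJump γ ρs ε b ρ) (Ioo 0 ρs) :=
  (strictMonoOn_compositeJump hγ hε ha).add (strictMonoOn_compositeJump hγ hε hb)

/-- The intermediate density of a solution whose intermediate state is not the vacuum satisfies the
scalar equation of the composite wave curves. -/
lemma IsRiemannSolution.exists_density_or_vacuum {γ ρs ε : ℝ} {U : ℝ → ℝ × ℝ} {l r : ℝ × ℝ}
    (hγ : 0 < γ) (hε : 0 < ε) (hl : l.1 ∈ Ioo 0 ρs) (hr : r.1 ∈ Ioo 0 ρs)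
    (h : IsRiemannSolution γ ρs ε l r U) :
    (∃ ρ ∈ Ioo 0 ρs, compositeJump γ ρs ε l.1 ρ + compositeJump γ ρs ε r.1 ρ =
        l.2 / l.1 - r.2 / r.1 ∧
      (ρ = l.1 ∨ ρ = r.1 ∨ ∃ w₁ w₂, IsAdmissibleJump w₁ l.1 ρ ∧ IsAdmissibleJump w₂ r.1 ρ ∧
        HasForm γ ρs ε l r w₁ w₂ (ρ, ρ * (l.2 / l.1 - velocityJump γ ρs ε w₁ l.1 ρ)) U)) ∨
    ((∀ ρ, 0 < ρ → ρ < l.1 → ρ < r.1 → l.2 / l.1 - r.2 / r.1 <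
        √ε * (2 * speedPotential γ ρs ρ - soundPotential γ ρs l.1 - soundPotential γ ρs r.1)) ∧
      (BddBelow (soundPotential γ ρs '' Ioo 0 ρs) →
        HasForm γ ρs ε l r .rarefaction .rarefaction (0, 0) U)) := by
  have hρs := hl.1.trans hl.2
  rcases h.structure hγ hρs hε with rfl | ⟨a, b, w, hw⟩ | ⟨a, b, w, hw⟩ | ⟨w₁, w₂, m, hform⟩
  -- A missing wave counts as a zero jump, so degenerate solutions solve the same equation, with an
  -- outer density as root.
  · exact Or.inl ⟨l.1, hl, by simp [compositeJump_self], Or.inl rfl⟩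
  · obtain ⟨h1, -, -, h4⟩ := (hw.first_spec hγ hρs hε).2.2.2.2.1 hr.1
    refine Or.inl ⟨r.1, hr, ?_, Or.inr (Or.inl rfl)⟩
    rw [compositeJump_self, h4.compositeJump_eq, h1]
    ring
  · obtain ⟨h1, -, -, h4⟩ := (hw.second_spec hγ hρs hε).2.2.2.2.1 hl.1
    refine Or.inl ⟨l.1, hl, ?_, Or.inl rfl⟩
    rw [compositeJump_self, h4.compositeJump_eq, h1]
    ring
  · obtain ⟨a₁, b₁, a₂, b₂, -, hba, -, -, hw1, -, hw2, -⟩ := id hform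
    obtain ⟨-, hm, -, -, h1, h2⟩ := hw1.first_spec hγ hρs hε
    obtain ⟨-, -, -, -, h3, h4⟩ := hw2.second_spec hγ hρs hε
    rcases hm.1.eq_or_lt with h0 | h0
    · obtain ⟨rfl, e2, e3⟩ := h2 h0.symm
      obtain ⟨rfl, e5, -⟩ := h4 h0.symm
      refine Or.inr ⟨fun ρ hρ hρl hρr => ?_, fun hb => e3 hb ▸ hform⟩
      have i1 := e2 ρ ⟨hρ, hρl⟩
      have i2 := e5 ρ ⟨hρ, hρr⟩
      linarith
    · obtain ⟨e1, -, -, e2⟩ := h1 h0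
      obtain ⟨e3, -, -, e4⟩ := h3 h0
      refine Or.inl ⟨m.1, ⟨h0, hm.2⟩, ?_, Or.inr (Or.inr ⟨w₁, w₂, e2, e4, ?_⟩)⟩
      · rw [e2.compositeJump_eq, e4.compositeJump_eq]
        linarith
      · rwa [← e1, mul_div_cancel₀ _ h0.ne']

/-! ### Gluing of waves, and existence with uniqueness of form. -/

lemma exists_isWave_first {γ ρs ε : ℝ} {w : WaveKind} {L R : ℝ × ℝ} (hγ : 0 < γ) (hε : 0 < ε)
    (hL : L.1 ∈ Ioo 0 ρs) (hR : R.1 ∈ Ioo 0 ρs) (hw : IsAdmissibleJump w L.1 R.1)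
    (h : R.2 / R.1 = L.2 / L.1 - velocityJump γ ρs ε w L.1 R.1) :
    ∃ U a b, IsWave γ ρs ε .first w U a b L R := by
  rcases hw with ⟨rfl, hw⟩ | ⟨rfl, hw⟩
  · obtain ⟨σ, hσ⟩ := exists_isShock_first hγ hε hL.1 hw hR.2 h
    -- A shock puts no condition on the profile, so any function serves.
    exact ⟨fun _ => L, σ, σ, rfl, hσ⟩
  · exact exists_isRarefaction_first hγ hε hR.1 hw hL.2 h

lemma exists_isWave_second {γ ρs ε : ℝ} {w : WaveKind} {L R : ℝ × ℝ} (hγ : 0 < γ) (hε : 0 < ε)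
    (hL : L.1 ∈ Ioo 0 ρs) (hR : R.1 ∈ Ioo 0 ρs) (hw : IsAdmissibleJump w R.1 L.1)
    (h : L.2 / L.1 = R.2 / R.1 + velocityJump γ ρs ε w R.1 L.1) :
    ∃ U a b, IsWave γ ρs ε .second w U a b L R := by
  obtain ⟨U, a, b, hU⟩ := exists_isWave_first (L := mirror R) (R := mirror L) hγ hε hR hL hw
    (by simp only [mirror_fst, mirror_snd, neg_div]; linarith)
  have := hU.mirror (k' := .second) hγ hε (by simp [Family.sgn])
  rw [mirror_mirror, mirror_mirror] at this
  exact ⟨_, _, _, this⟩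

lemma exists_isRiemannSolution_of_isWave {γ ρs ε a₁ b₁ a₂ b₂ : ℝ} {w₁ w₂ : WaveKind}
    {U₁ U₂ : ℝ → ℝ × ℝ} {l m r : ℝ × ℝ} (hγ : 0 < γ) (hε : 0 < ε)
    (h₁ : IsWave γ ρs ε .first w₁ U₁ a₁ b₁ l m) (h₂ : IsWave γ ρs ε .second w₂ U₂ a₂ b₂ m r)
    (h : b₁ < a₂) : ∃ U, IsRiemannSolution γ ρs ε l r U := by
  have hle₁ := h₁.le
  have hle₂ := h₂.le
  refine ⟨fun ξ => if ξ < a₁ then l else if ξ ≤ b₁ then U₁ ξ else if ξ < a₂ then m else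
    if ξ ≤ b₂ then U₂ ξ else r, a₁ - 1, fun ξ hξ => ?_, ?_⟩
  · simp only [if_pos (show ξ < a₁ by linarith)]
  refine .wave _ a₁ b₁ l m .first w₁ (by linarith) (fun ξ hξ => ?_) (h₁.congr hγ hε fun ξ hξ => ?_)
    (.wave _ a₂ b₂ m r .second w₂ h (fun ξ hξ => ?_) (h₂.congr hγ hε fun ξ hξ => ?_)
      (.const _ fun ξ hξ => ?_))
  · simp only [if_pos hξ.2]
  · simp only [if_neg hξ.1.not_gt, if_pos hξ.2]
  · simp only [if_neg (show ¬ξ < a₁ by linarith [hξ.1]), if_neg hξ.1.not_ge, if_pos hξ.2]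
  · simp only [if_neg (show ¬ξ < a₁ by linarith [hξ.1]), if_neg (show ¬ξ ≤ b₁ by linarith [hξ.1]),
      if_neg hξ.1.not_gt, if_pos hξ.2]
  · simp only [if_neg (show ¬ξ < a₁ by linarith), if_neg (show ¬ξ ≤ b₁ by linarith),
      if_neg (show ¬ξ < a₂ by linarith), if_neg hξ.not_ge]

lemma waveCurve_eq_iff {γ ρs ε ρ : ℝ} {w₁ w₂ : WaveKind} {l r : ℝ × ℝ} (hl : 0 < l.1)
    (hr : 0 < r.1) (hρ : 0 < ρ) :
    waveCurve γ ρs ε .first w₁ l ρ = waveCurve γ ρs ε .second w₂ r ρ ↔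
      velocityJump γ ρs ε w₁ l.1 ρ + velocityJump γ ρs ε w₂ r.1 ρ =
        l.2 / l.1 - r.2 / r.1 := by
  rw [waveCurve_eq _ _ hl hρ, waveCurve_eq _ _ hr hρ, mul_right_inj' hρ.ne']
  simp only [Family.sgn]
  constructor <;> intro h <;> linarith

/-- The waves can be glued because the 1-wave ends below the intermediate velocity and the 2-wave
starts above it. Every solution has this form because the composite equation has one root, which
differs from both outer densities by admissibility. -/
theorem solvedByCurves_of_density {γ ρs ε ρ : ℝ} {w₁ w₂ : WaveKind} {l r : ℝ × ℝ}
    (hγ : 0 < γ) (hε : 0 < ε) (hl : l.1 ∈ Ioo 0 ρs) (hr : r.1 ∈ Ioo 0 ρs) (hρ : ρ ∈ Ioo 0 ρs)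
    (h₁ : IsAdmissibleJump w₁ l.1 ρ) (h₂ : IsAdmissibleJump w₂ r.1 ρ)
    (h : velocityJump γ ρs ε w₁ l.1 ρ + velocityJump γ ρs ε w₂ r.1 ρ = l.2 / l.1 - r.2 / r.1) :
    SolvedByCurves γ ρs ε l r w₁ w₂
      (ρ, ρ * (l.2 / l.1 - velocityJump γ ρs ε w₁ l.1 ρ)) := by
  have hρs := hl.1.trans hl.2
  refine ⟨⟨?_, fun U hU => ?_⟩, hρ.1.le, hρ.2, ?_, ?_, fun x hx0 hxs hx => ?_⟩
  · have e : ρ * (l.2 / l.1 - velocityJump γ ρs ε w₁ l.1 ρ) / ρ =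
      l.2 / l.1 - velocityJump γ ρs ε w₁ l.1 ρ := mul_div_cancel_left₀ _ hρ.1.ne'
    obtain ⟨U₁, a₁, b₁, hU₁⟩ := exists_isWave_first
      (R := (ρ, ρ * (l.2 / l.1 - velocityJump γ ρs ε w₁ l.1 ρ))) hγ hε hl hρ h₁ e
    obtain ⟨U₂, a₂, b₂, hU₂⟩ := exists_isWave_second
      (L := (ρ, ρ * (l.2 / l.1 - velocityJump γ ρs ε w₁ l.1 ρ))) hγ hε hρ hr h₂
      (e.trans (by simp only; linarith))
    exact exists_isRiemannSolution_of_isWave hγ hε hU₁ hU₂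
      (((hU₁.first_spec hγ hρs hε).2.2.2.2.1 hρ.1).2.2.1.trans
        ((hU₂.second_spec hγ hρs hε).2.2.2.2.1 hρ.1).2.2.1)
  · rw [← h₁.compositeJump_eq, ← h₂.compositeJump_eq] at h
    rcases hU.exists_density_or_vacuum hγ hε hl hr with ⟨x, hx, hxe, hx'⟩ | ⟨hv, -⟩
    · obtain rfl : x = ρ :=
        (strictMonoOn_compositeJump_add hγ hε hl hr).injOn hx hρ (hxe.trans h.symm)
      rcases hx' with hx' | hx' | ⟨w₁', w₂', h₁', h₂', hx'⟩
      · exact absurd hx' h₁.ne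
      · exact absurd hx' h₂.ne
      · rwa [h₁.unique h₁', h₂.unique h₂']
    · exfalso
      -- A vacuum solution would put `D` below the rarefaction sum with `P` replaced by the speed
      -- potential, at all small densities. At `m`, below `ρ` and both outer densities, the
      -- composite sum is at most `D` and involves only `P`; a density whose speed potential is less
      -- than `P(m)` gives the contradiction.
      obtain ⟨m, hm⟩ : ∃ m, m = min ρ (min l.1 r.1) := ⟨_, rfl⟩
      have hmρ : m ≤ ρ := hm ▸ min_le_left _ _
      have hml : m ≤ l.1 := hm ▸ (min_le_right _ _).trans (min_le_left _ _)
      have hmr : m ≤ r.1 := hm ▸ (min_le_right _ _).trans (min_le_right _ _)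
      have hm0 : m ∈ Ioo 0 ρs := ⟨hm ▸ lt_min hρ.1 (lt_min hl.1 hr.1), hmρ.trans_lt hρ.2⟩
      obtain ⟨x, hx, hxm⟩ := exists_speedPotential_lt_soundPotential hγ hm0
      have h1 := hv x hx.1 (hx.2.trans_le hml) (hx.2.trans_le hmr)
      have h2 := (strictMonoOn_compositeJump_add hγ hε hl hr).monotoneOn hm0 hρ hmρ
      simp only [h] at h2
      simp only [compositeJump, if_pos hml, if_pos hmr, velocityJump] at h2
      have h3 := mul_lt_mul_of_pos_left hxm (Real.sqrt_pos.2 hε)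
      linarith
  · rw [waveCurve_eq _ _ hl.1 hρ.1]
    simp only [Family.sgn]
    ring
  · rw [waveCurve_eq _ _ hr.1 hρ.1]
    simp only [Family.sgn]
    rw [eq_sub_of_add_eq' h]
    ring
  · rw [waveCurve_eq_iff hl.1 hr.1 hx0] at hx
    exact ((strictMonoOn_velocityJump w₁ hγ hε hl).add
      (strictMonoOn_velocityJump w₂ hγ hε hr)).injOn ⟨hx0, hxs⟩ hρ (hx.trans h.symm)

/-- The hypothesis says that the two rarefactions ending in the vacuum leave an open sector between
them. It also puts `D` below the composite sum at every positive density, which rules out any other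
solution. -/
theorem solvedByCurves_vacuum {γ ρs ε : ℝ} {l r : ℝ × ℝ}
    (hγ : 0 < γ) (hε : 0 < ε) (hl : l.1 ∈ Ioo 0 ρs) (hr : r.1 ∈ Ioo 0 ρs)
    (hP : BddBelow (soundPotential γ ρs '' Ioo 0 ρs))
    (h : l.2 / l.1 - r.2 / r.1 < √ε * (2 * sInf (soundPotential γ ρs '' Ioo 0 ρs) -
      soundPotential γ ρs l.1 - soundPotential γ ρs r.1)) :
    SolvedByCurves γ ρs ε l r .rarefaction .rarefaction (0, 0) := by
  have hρs := hl.1.trans hl.2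
  have hle : ∀ x ∈ Ioo 0 ρs, l.2 / l.1 - r.2 / r.1 <
      velocityJump γ ρs ε .rarefaction l.1 x + velocityJump γ ρs ε .rarefaction r.1 x := by
    intro x hx
    have := mul_le_mul_of_nonneg_left (csInf_le hP (mem_image_of_mem _ hx)) (Real.sqrt_nonneg ε)
    simp only [velocityJump]
    linarith
  refine ⟨⟨?_, fun U hU => ?_⟩, le_rfl, hρs, (waveCurve_zero ..).symm, (waveCurve_zero ..).symm,
    fun x hx0 hxs hx => ?_⟩
  · obtain ⟨U₁, a₁, hU₁⟩ := exists_isRarefaction_first_vacuum hγ hε hl hP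
    obtain ⟨U₂, a₂, hU₂⟩ := exists_isRarefaction_first_vacuum (L := mirror r) hγ hε hr hP
    have hU₂' := IsRarefaction.mirror (k' := .second) hγ hε (by simp [Family.sgn]) hU₂
    rw [mirror_mirror, show mirror (0, 0) = (0, 0) by simp [mirror]] at hU₂'
    refine exists_isRiemannSolution_of_isWave (w₁ := .rarefaction) (w₂ := .rarefaction) hγ hε
      hU₁ hU₂' ?_
    simp only [mirror_fst, mirror_snd, neg_div]
    linarith
  · rcases hU.exists_density_or_vacuum hγ hε hl hr with ⟨x, hx, hxe, -⟩ | ⟨-, hv⟩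
    · exfalso
      obtain ⟨m, hm⟩ : ∃ m, m = min x (min l.1 r.1) := ⟨_, rfl⟩
      have hmx : m ≤ x := hm ▸ min_le_left _ _
      have hml : m ≤ l.1 := hm ▸ (min_le_right _ _).trans (min_le_left _ _)
      have hmr : m ≤ r.1 := hm ▸ (min_le_right _ _).trans (min_le_right _ _)
      have hm0 : m ∈ Ioo 0 ρs := ⟨hm ▸ lt_min hx.1 (lt_min hl.1 hr.1), hmx.trans_lt hx.2⟩
      have h1 := hle m hm0
      have h2 := (strictMonoOn_compositeJump_add hγ hε hl hr).monotoneOn hm0 hx hmx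
      simp only [hxe] at h2
      simp only [compositeJump, if_pos hml, if_pos hmr] at h2
      linarith
    · exact hv hP
  · rw [waveCurve_eq_iff hl.1 hr.1 hx0] at hx
    exact absurd hx (hle x ⟨hx0, hxs⟩).ne'

/-! ### Location of the root in the four wave patterns. -/

lemma exists_solvedByCurves_shock_rarefaction {γ ρs ε : ℝ} {l r : ℝ × ℝ} (hγ : 0 < γ)
    (hε : 0 < ε) (hl : l.1 ∈ Ioo 0 ρs) (hr : r.1 ∈ Ioo 0 ρs) (hlr : l.1 < r.1)
    (h0 : r.2 / r.1 ≤ l.2 / l.1)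
    (h1 : l.2 / l.1 - r.2 / r.1 < velocityJump γ ρs ε .shock l.1 r.1) :
    ∃ m, SolvedByCurves γ ρs ε l r .shock .rarefaction m ∧ m.1 ∈ Icc l.1 r.1 := by
  have hc : ContinuousOn (fun ρ => velocityJump γ ρs ε .shock l.1 ρ +
      velocityJump γ ρs ε .rarefaction r.1 ρ) (Icc l.1 r.1) :=
    ((continuousOn_velocityJump_shock hγ hl.1).mono fun x hx => ⟨hx.1, hx.2.trans_lt hr.2⟩).add
      ((continuousOn_velocityJump_rarefaction hγ).mono fun x hx =>
        ⟨hl.1.trans_le hx.1, hx.2.trans_lt hr.2⟩)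
  -- At the lower density only the negative rarefaction jump remains, at the upper one only the
  -- shock jump; `D` lies strictly between.
  have hneg := strictMonoOn_velocityJump .rarefaction hγ hε hr hl hr hlr
  rw [velocityJump_self] at hneg
  obtain ⟨ρ, hρ, he⟩ := intermediate_value_Ioo hlr.le hc
    (show l.2 / l.1 - r.2 / r.1 ∈ Ioo _ _ by
      simp only [velocityJump_self, zero_add, add_zero]
      exact ⟨by linarith, h1⟩)
  exact ⟨_, solvedByCurves_of_density hγ hε hl hr ⟨hl.1.trans hρ.1, hρ.2.trans hr.2⟩
    (Or.inl ⟨rfl, hρ.1⟩) (Or.inr ⟨rfl, hρ.2⟩) he, Ioo_subset_Icc_self hρ⟩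

lemma exists_solvedByCurves_rarefaction_shock {γ ρs ε : ℝ} {l r : ℝ × ℝ} (hγ : 0 < γ)
    (hε : 0 < ε) (hl : l.1 ∈ Ioo 0 ρs) (hr : r.1 ∈ Ioo 0 ρs) (hrl : r.1 < l.1)
    (h0 : r.2 / r.1 ≤ l.2 / l.1)
    (h1 : l.2 / l.1 - r.2 / r.1 < velocityJump γ ρs ε .shock r.1 l.1) :
    ∃ m, SolvedByCurves γ ρs ε l r .rarefaction .shock m ∧ m.1 ∈ Icc r.1 l.1 := by
  have hc : ContinuousOn (fun ρ => velocityJump γ ρs ε .rarefaction l.1 ρ +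
      velocityJump γ ρs ε .shock r.1 ρ) (Icc r.1 l.1) :=
    ((continuousOn_velocityJump_rarefaction hγ).mono fun x hx =>
      ⟨hr.1.trans_le hx.1, hx.2.trans_lt hl.2⟩).add
    ((continuousOn_velocityJump_shock hγ hr.1).mono fun x hx => ⟨hx.1, hx.2.trans_lt hl.2⟩)
  have hneg := strictMonoOn_velocityJump .rarefaction hγ hε hl hr hl hrl
  rw [velocityJump_self] at hneg
  obtain ⟨ρ, hρ, he⟩ := intermediate_value_Ioo hrl.le hc
    (show l.2 / l.1 - r.2 / r.1 ∈ Ioo _ _ by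
      simp only [velocityJump_self, zero_add, add_zero]
      exact ⟨by linarith, h1⟩)
  exact ⟨_, solvedByCurves_of_density hγ hε hl hr ⟨hr.1.trans hρ.1, hρ.2.trans hl.2⟩
    (Or.inr ⟨rfl, hρ.2⟩) (Or.inl ⟨rfl, hρ.1⟩) he, Ioo_subset_Icc_self hρ⟩

lemma exists_solvedByCurves_shock_shock {γ ρs ε : ℝ} {l r : ℝ × ℝ} (hγ : 0 < γ)
    (hε : 0 < ε) (hl : l.1 ∈ Ioo 0 ρs) (hr : r.1 ∈ Ioo 0 ρs)
    (h1 : velocityJump γ ρs ε .shock l.1 r.1 < l.2 / l.1 - r.2 / r.1)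
    (h2 : velocityJump γ ρs ε .shock r.1 l.1 < l.2 / l.1 - r.2 / r.1) :
    ∃ m, SolvedByCurves γ ρs ε l r .shock .shock m := by
  obtain ⟨b, ⟨hb, hbs⟩, hlb, hK⟩ :=
    exists_lt_velocityJump_shock hγ hε hl (l.2 / l.1 - r.2 / r.1) (max_lt hl.2 hr.2)
  have hrb : r.1 < b := (le_max_right _ _).trans_lt hb
  have hc : ContinuousOn (fun ρ => velocityJump γ ρs ε .shock l.1 ρ +
      velocityJump γ ρs ε .shock r.1 ρ) (Icc (max l.1 r.1) b) :=
    ((continuousOn_velocityJump_shock hγ hl.1).mono fun x hx =>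
      ⟨(le_max_left _ _).trans hx.1, hx.2.trans_lt hbs⟩).add
    ((continuousOn_velocityJump_shock hγ hr.1).mono fun x hx =>
      ⟨(le_max_right _ _).trans hx.1, hx.2.trans_lt hbs⟩)
  have hpos := strictMonoOn_velocityJump .shock hγ hε hr hr ⟨hr.1.trans hrb, hbs⟩ hrb
  rw [velocityJump_self] at hpos
  obtain ⟨ρ, hρ, he⟩ := intermediate_value_Ioo hb.le hc
    (show l.2 / l.1 - r.2 / r.1 ∈ Ioo _ _ by
      refine ⟨?_, by linarith⟩
      rcases le_total l.1 r.1 with h | h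
      · simpa only [max_eq_right h, velocityJump_self, add_zero] using h1
      · simpa only [max_eq_left h, velocityJump_self, zero_add] using h2)
  have hlρ : l.1 < ρ := (le_max_left _ _).trans_lt hρ.1
  exact ⟨_, solvedByCurves_of_density hγ hε hl hr ⟨hl.1.trans hlρ, hρ.2.trans hbs⟩
    (Or.inl ⟨rfl, hlρ⟩) (Or.inl ⟨rfl, (le_max_right _ _).trans_lt hρ.1⟩) he⟩

/-- Either the sum of the jumps falls to `D` or below somewhere, which gives a root below both
densities, or it stays above `D`, which bounds `P` below and leads to the vacuum. The last
hypothesis excludes equality of `D` with the infimum, where the two fans would touch. -/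
lemma exists_solvedByCurves_rarefaction_rarefaction {γ ρs ε : ℝ} {l r : ℝ × ℝ} (hγ : 0 < γ)
    (hε : 0 < ε) (hl : l.1 ∈ Ioo 0 ρs) (hr : r.1 ∈ Ioo 0 ρs)
    (h1 : l.2 / l.1 - r.2 / r.1 < velocityJump γ ρs ε .rarefaction l.1 r.1)
    (h2 : l.2 / l.1 - r.2 / r.1 < velocityJump γ ρs ε .rarefaction r.1 l.1)
    (h3 : BddBelow (soundPotential γ ρs '' Ioo 0 ρs) → l.2 / l.1 - r.2 / r.1 <
      √ε * (2 * sInf (soundPotential γ ρs '' Ioo 0 ρs) -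
        soundPotential γ ρs l.1 - soundPotential γ ρs r.1)) :
    ∃ m, SolvedByCurves γ ρs ε l r .rarefaction .rarefaction m ∧ m.1 < l.1 ∧ m.1 < r.1 := by
  let F : ℝ → ℝ := fun ρ => velocityJump γ ρs ε .rarefaction l.1 ρ +
    velocityJump γ ρs ε .rarefaction r.1 ρ
  by_cases hex : ∃ ρ ∈ Ioo 0 ρs, F ρ ≤ l.2 / l.1 - r.2 / r.1
  · obtain ⟨a, ha, hFa⟩ := hex
    have hF : StrictMonoOn F (Ioo 0 ρs) := (strictMonoOn_velocityJump _ hγ hε hl).add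
      (strictMonoOn_velocityJump _ hγ hε hr)
    have hc : ContinuousOn F (Ioo 0 ρs) := (continuousOn_velocityJump_rarefaction hγ).add
      (continuousOn_velocityJump_rarefaction hγ)
    have hmin : min l.1 r.1 ∈ Ioo 0 ρs := ⟨lt_min hl.1 hr.1, (min_le_left _ _).trans_lt hl.2⟩
    have hFm : l.2 / l.1 - r.2 / r.1 < F (min l.1 r.1) := by
      rcases le_total l.1 r.1 with h | h
      · simpa only [F, min_eq_left h, velocityJump_self, zero_add] using h2
      · simpa only [F, min_eq_right h, velocityJump_self, add_zero] using h1
    have ham : a < min l.1 r.1 := (hF.lt_iff_lt ha hmin).1 (hFa.trans_lt hFm)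
    obtain ⟨ρ, hρ, he⟩ := intermediate_value_Ico ham.le
      (hc.mono fun x hx => ⟨ha.1.trans_le hx.1, hx.2.trans_lt hmin.2⟩) ⟨hFa, hFm⟩
    obtain ⟨hρl, hρr⟩ := lt_min_iff.1 hρ.2
    exact ⟨_, solvedByCurves_of_density hγ hε hl hr ⟨ha.1.trans_le hρ.1, hρl.trans hl.2⟩
      (Or.inr ⟨rfl, hρl⟩) (Or.inr ⟨rfl, hρr⟩) he, hρl, hρr⟩
  · push Not at hex
    have hs := Real.sqrt_pos.2 hε
    have hP : BddBelow (soundPotential γ ρs '' Ioo 0 ρs) := by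
      refine ⟨((l.2 / l.1 - r.2 / r.1) / √ε + soundPotential γ ρs l.1 +
        soundPotential γ ρs r.1) / 2, ?_⟩
      rintro _ ⟨ρ, hρ, rfl⟩
      have h : (l.2 / l.1 - r.2 / r.1) / √ε < 2 * soundPotential γ ρs ρ -
          soundPotential γ ρs l.1 - soundPotential γ ρs r.1 := by
        rw [div_lt_iff₀ hs]
        have := hex ρ hρ
        simp only [F, velocityJump] at this
        linarith
      linarith
    exact ⟨_, solvedByCurves_vacuum hγ hε hl hr hP (h3 hP), hl.1, hr.1⟩

/-! ### Vanishing of the sound potential in the limit. -/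

/-- The sound potential grows slower than the square root of the pressure. -/
lemma exists_soundPotential_le_rpow {γ ρs a : ℝ} (hγ : 0 < γ) (ha : a ∈ Ioo 0 ρs) :
    ∃ θ K : ℝ, 0 < θ ∧ θ < 1 / 2 ∧ ∀ ρ ∈ Ico a ρs,
      soundPotential γ ρs ρ ≤ K + K * pressure γ ρs ρ ^ θ := by
  -- In the excess `w`, `Z` is of order `w^(-(γ+1)/2)` and `p = w^(-γ)`. With `b ≥ (γ-1)/2`,
  -- `w^(-b)` controls `P`; `b < γ/2` makes the exponent `b/γ` less than `1/2`, and `γ/4` only keeps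
  -- `b` positive.
  obtain ⟨b, hb⟩ : ∃ b, b = max ((γ - 1) / 2) (γ / 4) := ⟨_, rfl⟩
  have hb1 : (γ - 1) / 2 ≤ b := hb ▸ le_max_left _ _
  have hb2 : γ / 4 ≤ b := hb ▸ le_max_right _ _
  have hb3 : b < γ / 2 := hb ▸ max_lt (by linarith) (by linarith)
  have hb0 : 0 < b := by linarith
  have hw₀ := specificVolume_excess_pos ha
  set w₀ := 1 / a - 1 / ρs with hw₀_def
  -- `M` is chosen so that `M b w^(-b-1) ≥ Z` for all `w ≤ w₀`.
  obtain ⟨M, hM⟩ : ∃ M, M = √γ * w₀ ^ (b + 1 - (γ + 1) / 2) / b := ⟨_, rfl⟩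
  have hM0 : 0 ≤ M := hM ▸ by positivity
  have hIoo : Ico a ρs ⊆ Ioo 0 ρs := fun x hx => ⟨ha.1.trans_le hx.1, hx.2⟩
  have hderiv : ∀ x ∈ Ioo 0 ρs, HasDerivAt (fun x => M * (1 / x - 1 / ρs) ^ (-b) -
      soundPotential γ ρs x) ((M * (b * (1 / x - 1 / ρs) ^ (-b - 1)) - impedance γ ρs x) / x ^ 2)
      x := fun x hx => by
    have h := (((hasDerivAt_specificVolume_excess (ρs := ρs) hx.1.ne').rpow_const (p := -b)
      (Or.inl (specificVolume_excess_pos hx).ne')).const_mul M).sub (hasDerivAt_soundPotential hγ hx)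
    exact h.congr_deriv (by ring)
  have hmono : MonotoneOn (fun x => M * (1 / x - 1 / ρs) ^ (-b) - soundPotential γ ρs x)
      (Ico a ρs) := by
    refine monotoneOn_of_deriv_nonneg (convex_Ico a ρs)
      (fun x hx => (hderiv x (hIoo hx)).continuousAt.continuousWithinAt)
      (fun x hx => (hderiv x (hIoo (interior_subset hx))).differentiableAt.differentiableWithinAt)
      fun x hx => ?_
    have hx := interior_subset hx
    rw [(hderiv x (hIoo hx)).deriv]
    refine div_nonneg (sub_nonneg.2 ?_) (sq_nonneg x)
    have hw := specificVolume_excess_pos (hIoo hx)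
    have hww : 1 / x - 1 / ρs ≤ w₀ := sub_le_sub_right (one_div_le_one_div_of_le ha.1 hx.1) _
    rw [impedance]
    set w := 1 / x - 1 / ρs with hw_def
    have e : w ^ (-((γ + 1) / 2)) = w ^ (b + 1 - (γ + 1) / 2) * w ^ (-b - 1) := by
      rw [← Real.rpow_add hw]; congr 1; ring
    rw [e, hM]
    have hle : w ^ (b + 1 - (γ + 1) / 2) ≤ w₀ ^ (b + 1 - (γ + 1) / 2) :=
      Real.rpow_le_rpow hw.le hww (by linarith)
    calc √γ * (w ^ (b + 1 - (γ + 1) / 2) * w ^ (-b - 1))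
        ≤ √γ * (w₀ ^ (b + 1 - (γ + 1) / 2) * w ^ (-b - 1)) := by gcongr
      _ = _ := by field_simp
  refine ⟨b / γ, max M (soundPotential γ ρs a), by positivity, ?_, fun ρ hρ => ?_⟩
  · rw [div_lt_iff₀ hγ]; linarith
  · have h := hmono (left_mem_Ico.2 ha.2) hρ hρ.1
    simp only at h
    have hw := specificVolume_excess_pos (hIoo hρ)
    have e : pressure γ ρs ρ ^ (b / γ) = (1 / ρ - 1 / ρs) ^ (-b) := by
      rw [pressure_eq (hIoo hρ), ← Real.rpow_mul hw.le]
      congr 1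
      field_simp
    rw [e]
    have h0 : 0 ≤ M * (1 / a - 1 / ρs) ^ (-b) := by positivity
    have h1 : M * (1 / ρ - 1 / ρs) ^ (-b) ≤
        max M (soundPotential γ ρs a) * (1 / ρ - 1 / ρs) ^ (-b) :=
      mul_le_mul_of_nonneg_right (le_max_left _ _) (Real.rpow_nonneg hw.le _)
    linarith [le_max_right M (soundPotential γ ρs a)]

lemma tendsto_sqrt_nhdsGT_zero : Tendsto (fun ε => √ε) (𝓝[>] (0 : ℝ)) (𝓝 0) := by
  have := (Real.continuous_sqrt.tendsto 0).mono_left (nhdsWithin_le_nhds (s := Ioi 0))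
  rwa [Real.sqrt_zero] at this

/-- From `P ≤ K + K p^θ` with `θ < 1/2`, the product `√ε p^θ = ε^(1/2-θ) (ε p)^θ` tends to zero as
soon as `ε p` converges. Below, `P` is bounded by its value at a fixed density. -/
lemma tendsto_sqrt_mul_soundPotential {γ ρs ρ₀ p₀ : ℝ} {ρ : ℝ → ℝ} (hγ : 0 < γ) (hρs : 0 < ρs)
    (hρ : ∀ ε, 0 < ε → ρ ε ∈ Ioo 0 ρs) (hρ₀ : 0 < ρ₀) (hlim : Tendsto ρ (𝓝[>] 0) (𝓝 ρ₀))
    (hp : Tendsto (fun ε => ε * pressure γ ρs (ρ ε)) (𝓝[>] 0) (𝓝 p₀)) :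
    Tendsto (fun ε => √ε * soundPotential γ ρs (ρ ε)) (𝓝[>] 0) (𝓝 0) := by
  obtain ⟨a, ha0, ha⟩ := exists_between (lt_min hρ₀ hρs)
  have haI : a ∈ Ioo 0 ρs := ⟨ha0, ha.trans_le (min_le_right _ _)⟩
  obtain ⟨θ, K, hθ0, hθ, hK⟩ := exists_soundPotential_le_rpow hγ haI
  have hev : ∀ᶠ ε in 𝓝[>] (0 : ℝ), 0 < ε ∧ ρ ε ∈ Ico a ρs := by
    filter_upwards [eventually_mem_nhdsWithin,
      hlim.eventually (lt_mem_nhds (ha.trans_le (min_le_left _ _)))] with ε hε h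
    exact ⟨hε, h.le, (hρ ε hε).2⟩
  have h1 : Tendsto (fun ε => √ε * soundPotential γ ρs a) (𝓝[>] 0) (𝓝 0) := by
    simpa using tendsto_sqrt_nhdsGT_zero.mul_const (soundPotential γ ρs a)
  have h2 : Tendsto (fun ε => √ε * K + K * (ε ^ (1 / 2 - θ) * (ε * pressure γ ρs (ρ ε)) ^ θ))
      (𝓝[>] 0) (𝓝 0) := by
    have e1 : Tendsto (fun ε : ℝ => ε ^ (1 / 2 - θ)) (𝓝[>] 0) (𝓝 0) := by
      have := ((Real.continuousAt_rpow_const 0 (1 / 2 - θ) (Or.inr (by linarith))).tendsto).mono_left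
        (nhdsWithin_le_nhds (s := Ioi 0))
      rwa [Real.zero_rpow (by linarith)] at this
    have e2 := hp.rpow_const (p := θ) (Or.inr hθ0.le)
    simpa using (tendsto_sqrt_nhdsGT_zero.mul_const K).add ((e1.mul e2).const_mul K)
  refine tendsto_of_tendsto_of_tendsto_of_le_of_le' h1 h2 ?_ ?_
  · filter_upwards [hev] with ε hε
    exact mul_le_mul_of_nonneg_left ((strictMonoOn_soundPotential hγ).monotoneOn haI
      (hρ ε hε.1) hε.2.1) (Real.sqrt_nonneg ε)
  · filter_upwards [hev] with ε hε
    have hpos : 0 ≤ pressure γ ρs (ρ ε) := by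
      rw [pressure_eq (hρ ε hε.1)]
      exact Real.rpow_nonneg (specificVolume_excess_pos (hρ ε hε.1)).le _
    refine (mul_le_mul_of_nonneg_left (hK _ hε.2) (Real.sqrt_nonneg ε)).trans_eq ?_
    rw [Real.mul_rpow hε.1.le hpos, ← mul_assoc (ε ^ (1 / 2 - θ)), ← Real.rpow_add hε.1,
      sub_add_cancel, ← Real.sqrt_eq_rpow]
    ring

/-! ### The three cases of the theorem. -/

lemma hugoniotCurve_eq {γ ρs ε ρ : ℝ} (k : Family) {v : ℝ × ℝ} (hv : 0 < v.1)
    (hρ : 0 < ρ) : hugoniotCurve γ ρs ε k v ρ =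
      ρ * (v.2 / v.1 + k.sgn * velocityJump γ ρs ε .shock v.1 ρ) :=
  waveCurve_eq k .shock hv hρ

theorem mainTheorem4
    (γ ρs : ℝ) (hγ : 0 < γ) (hρs : 0 < ρs)
    -- left and right states `(ρ, q)`, possibly depending on `ε`
    (l r : ℝ → ℝ × ℝ)
    (hl : ∀ ε, 0 < ε → 0 < (l ε).1 ∧ (l ε).1 < ρs)
    (hr : ∀ ε, 0 < ε → 0 < (r ε).1 ∧ (r ε).1 < ρs)
    -- limits of the states and of the pressures; the limit densities may equal `ρs`
    (ρl ql pl ρr qr pr : ℝ) (hρl : 0 < ρl) (hρr : 0 < ρr)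
    (hl_lim : Tendsto l (𝓝[>] 0) (𝓝 (ρl, ql)))
    (hr_lim : Tendsto r (𝓝[>] 0) (𝓝 (ρr, qr)))
    (hpl : Tendsto (fun ε => ε * pressure γ ρs (l ε).1) (𝓝[>] 0) (𝓝 pl))
    (hpr : Tendsto (fun ε => ε * pressure γ ρs (r ε).1) (𝓝[>] 0) (𝓝 pr)) :
    (ql / ρl < qr / ρr → ∀ᶠ ε in 𝓝[>] (0 : ℝ),
      ∃ m : ℝ × ℝ, SolvedByCurves γ ρs ε (l ε) (r ε) .rarefaction .rarefaction m ∧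
        m.1 < (l ε).1 ∧ m.1 < (r ε).1) ∧
    (∀ᶠ ε in 𝓝[>] (0 : ℝ), (r ε).2 / (r ε).1 < (l ε).2 / (l ε).1 →
      (hugoniotCurve γ ρs ε .first (l ε) (r ε).1 > (r ε).2 →
        hugoniotCurve γ ρs ε .second (r ε) (l ε).1 < (l ε).2 →
        ∃ m : ℝ × ℝ, SolvedByCurves γ ρs ε (l ε) (r ε) .shock .shock m) ∧
      (hugoniotCurve γ ρs ε .first (l ε) (r ε).1 < (r ε).2 →
        ∃ m : ℝ × ℝ, SolvedByCurves γ ρs ε (l ε) (r ε) .shock .rarefaction m) ∧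
      (hugoniotCurve γ ρs ε .second (r ε) (l ε).1 > (l ε).2 →
        ∃ m : ℝ × ℝ, SolvedByCurves γ ρs ε (l ε) (r ε) .rarefaction .shock m)) ∧
    (∀ ε, 0 < ε → (l ε).2 / (l ε).1 = (r ε).2 / (r ε).1 →
      ((l ε).1 < (r ε).1 →
        ∃ m : ℝ × ℝ, SolvedByCurves γ ρs ε (l ε) (r ε) .shock .rarefaction m ∧
          m.1 ∈ Icc (l ε).1 (r ε).1) ∧
      ((r ε).1 < (l ε).1 →
        ∃ m : ℝ × ℝ, SolvedByCurves γ ρs ε (l ε) (r ε) .rarefaction .shock m ∧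
          m.1 ∈ Icc (r ε).1 (l ε).1)) := by
  refine ⟨fun hu => ?_, ?_, fun ε hε hu => ⟨fun hlr => ?_, fun hrl => ?_⟩⟩
  · have hPl := tendsto_sqrt_mul_soundPotential hγ hρs hl hρl hl_lim.fst_nhds hpl
    have hPr := tendsto_sqrt_mul_soundPotential hγ hρs hr hρr hr_lim.fst_nhds hpr
    have hD : Tendsto (fun ε => (l ε).2 / (l ε).1 - (r ε).2 / (r ε).1) (𝓝[>] 0)
        (𝓝 (ql / ρl - qr / ρr)) :=
      (hl_lim.snd_nhds.div hl_lim.fst_nhds hρl.ne').sub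
        (hr_lim.snd_nhds.div hr_lim.fst_nhds hρr.ne')
    have hsum := hD.add (hPl.add hPr)
    -- The infimum is a fixed real number, so its product with `√ε` vanishes in the limit, whether
    -- or not `P` is bounded below.
    have hP₀ := hsum.sub (tendsto_sqrt_nhdsGT_zero.mul_const
      (2 * sInf (soundPotential γ ρs '' Ioo 0 ρs)))
    simp only [add_zero, zero_mul, sub_zero] at hP₀
    have h1 := hD.sub (hPr.sub hPl)
    have h2 := hD.sub (hPl.sub hPr)
    simp only [sub_zero] at h1 h2
    have hneg := gt_mem_nhds (sub_neg.2 hu)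
    filter_upwards [eventually_mem_nhdsWithin, h1.eventually hneg, h2.eventually hneg,
      hP₀.eventually hneg] with ε hε i1 i2 i3
    refine exists_solvedByCurves_rarefaction_rarefaction hγ hε (hl ε hε) (hr ε hε) ?_ ?_
      fun _ => ?_
    · simp only [velocityJump]; linarith
    · simp only [velocityJump]; linarith
    · linarith
  · filter_upwards [eventually_mem_nhdsWithin] with ε (hε : 0 < ε) hu
    have hlI : (l ε).1 ∈ Ioo 0 ρs := hl ε hε
    have hrI : (r ε).1 ∈ Ioo 0 ρs := hr ε hε
    have eql : (l ε).2 = (l ε).1 * ((l ε).2 / (l ε).1) := (mul_div_cancel₀ _ hlI.1.ne').symm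
    have eqr : (r ε).2 = (r ε).1 * ((r ε).2 / (r ε).1) := (mul_div_cancel₀ _ hrI.1.ne').symm
    have hfirst := hugoniotCurve_eq (γ := γ) (ρs := ρs) (ε := ε) .first hlI.1 hrI.1
    have hsecond := hugoniotCurve_eq (γ := γ) (ρs := ρs) (ε := ε) .second hrI.1 hlI.1
    simp only [Family.sgn] at hfirst hsecond
    refine ⟨fun h1 h2 => ?_, fun h1 => ?_, fun h1 => ?_⟩
    -- After division by the positive density, each Hugoniot condition compares `D` with a shock
    -- jump between the two outer densities.
    · rw [gt_iff_lt, hfirst, eqr, mul_lt_mul_iff_right₀ hrI.1] at h1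
      rw [hsecond, eql, mul_lt_mul_iff_right₀ hlI.1] at h2
      exact exists_solvedByCurves_shock_shock hγ hε hlI hrI (by linarith) (by linarith)
    · rw [hfirst, eqr, mul_lt_mul_iff_right₀ hrI.1] at h1
      -- The shock jump exceeds `D > 0`, and a positive jump means a larger density.
      have hlr : (l ε).1 < (r ε).1 :=
        ((strictMonoOn_velocityJump .shock hγ hε hlI).lt_iff_lt hlI hrI).1 (by
          rw [velocityJump_self]; linarith)
      obtain ⟨m, hm, -⟩ := exists_solvedByCurves_shock_rarefaction hγ hε hlI hrI hlr hu.le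
        (by linarith)
      exact ⟨m, hm⟩
    · rw [gt_iff_lt, hsecond, eql, mul_lt_mul_iff_right₀ hlI.1] at h1
      have hrl : (r ε).1 < (l ε).1 :=
        ((strictMonoOn_velocityJump .shock hγ hε hrI).lt_iff_lt hrI hlI).1 (by
          rw [velocityJump_self]; linarith)
      obtain ⟨m, hm, -⟩ := exists_solvedByCurves_rarefaction_shock hγ hε hlI hrI hrl hu.le
        (by linarith)
      exact ⟨m, hm⟩
  · have h := strictMonoOn_velocityJump .shock hγ hε (hl ε hε) (hl ε hε) (hr ε hε) hlr
    rw [velocityJump_self] at h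
    exact exists_solvedByCurves_shock_rarefaction hγ hε (hl ε hε) (hr ε hε) hlr hu.ge
      (by linarith)
  · have h := strictMonoOn_velocityJump .shock hγ hε (hr ε hε) (hr ε hε) (hl ε hε) hrl
    rw [velocityJump_self] at h
    exact exists_solvedByCurves_rarefaction_shock hγ hε (hl ε hε) (hr ε hε) hrl hu.ge
      (by linarith)
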